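/- **Definitions.** A normal pair $(N,F)$ is a group $F$ with a normal subgroup $N$; a morphism $(N,F)\to(M,G)$ is a homomorphism $F\to G$ mapping $N$ into $M$. Let $U_F$ be the free group on symbols $u_x$ ($x\in F$) with the normalization $u_1=1$; put $J_F=\ker(U_F\to F,\ u_x\mapsto x)$, $U_{N,F}=\ker(U_F\to U_{F/N})$ and $J_{N,F}=U_{N,F}\cap J_F$. Define $$K_1(N,F)=N/[N,F],\qquad K^J_2(N,F)=\frac{J_{N,F}\cap[U_{N,F},U_F]}{[J_{N,F},U_F]\,[U_{N,F},J_F]},\qquad K^J_{k+2}(N,F)=K^J_2(J^k_{N,F},U^k_F),$$ where $(J^k_{N,F},U^k_F)$ is the $k$-th iterate of the suspension $(N,F)\mapsto(J_{N,F},U_F)$. For a normal pair $(P,E)$ put $\overline F=U_E/J_{P,E}$, and write $J_{E/P}$ and $P$ for the images of $J_E$ and $U_{P,E}$ in $\overline F$. The pair $(P,E)$ is *exact of first order* if $K^J_2(J_{E/P},\overline F)\to K^J_2(J_{E/P}\times P,\overline F)$ is injective, *exact of second order* if $(J_{E/P},\overline F)$ is exact of first order, and *fully exact* if both hold. The canonical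 $F$-central extension of $N$ is $\widetilde N=U_{N,F}/([J_{N,F},U_F][U_{N,F},J_F])$, on which $F$ acts through conjugation by $U_F$. For $[N,F]\subseteq N_0\subseteq N$ the pair $(N,F)$ is *partially admissible on $N_0$* if $\widetilde N$ contains an $F$-normal subgroup that contains $[\widetilde N,F]$ (the image of $[U_{N,F},U_F]$) and is an extension of $N_0$ by $K^J_2(N,F)$, i.e. it maps onto $N_0$ and meets the kernel of $\widetilde N\to N$ in $K^J_2(N,F)$. **Corollary 5.1.** Let $1\to(N,F)\xrightarrow{i}(M,F)\xrightarrow{p}(P,E)\to1$ be an extension of normal pairs, i.e. $N\subseteq M$ are normal in $F$, $E=F/N$ and $P=M/N$. There are boundary homomorphisms $\delta_*:K^J_{n+1}(P,E)\to K^J_n(N,F)$ ($n\ge2$) and $\delta_*:K^J_2(P,E)\to K_1(N,F)$, determined as follows. For $k\ge 0$ let $(C,U)$ be the mapping cone of $(J^k_{N,F},U^k_F)\to(J^k_{M,F},U^k_F)$, that is the pull-back of $(U_{J^k_{M,F},U^k_F},U^{k+1}_F)\to(J^k_{M,F},U^k_F)$ along this morphism; the composition of $K^J_2(C,U)\to K^J_2(J^{k+1}_{P,E},U^{k+1}_E)=K^J_{k+3}(P,E)$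 with $\delta_*$ is the map $K^J_2(C,U)\to K^J_{k+2}(N,F)$ induced by the projection of the cone. If $w\in[U_{M,F},U_F]$ evaluates to $a\in N$, then the second $\delta_*$ maps the class of the image of $w$ in $J_{P,E}\cap[U_{P,E},U_E]$ to the class of $a$. Consider the sequence $$\cdots\to K^J_{n+1}(P,E)\xrightarrow{\delta_*}K^J_n(N,F)\xrightarrow{i_*}K^J_n(M,F)\xrightarrow{p_*}K^J_n(P,E)\to\cdots\to K^J_2(P,E)\xrightarrow{\delta_*}K_1(N,F)\xrightarrow{i_*}K_1(M,F)\xrightarrow{p_*}K_1(P,E)\to0 .$$ 1. If $(N,F)$, $(M,F)$ and $(P,E)$ are fully exact, the sequence is exact. More precisely: * it is exact at $K^J_2(N,F)$ if $(P,E)$ is exact of first order; * it is exact at $K^J_3(P,E)$ if $(M,F)$ is exact of first order and $(P,E)$ is exact of second order; * it is exact at $K^J_3(M,F)$ if $(N,F)$ is exact of first order and $(M,F)$ is exact of second order; * it is exact at $K^J_3(N,F)$ if $(N,F)$ is exact of second order; * at all other places it is exact without any assumption. 2. The conditions on $(P,E)$ and $(N,F)$ are needed in the following sense. If for every extension with quotient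 $(P,E)$ the sequence is exact at $K^J_2(N,F)$, then $(P,E)$ is exact of first order; if for every extension with quotient $(P,E)$ and with $(M,F)$ exact of first order it is exact at $K^J_3(P,E)$, then $(P,E)$ is exact of second order. If for every extension with kernel $(N,F)$ and with $(M,F)$ exact of second order it is exact at $K^J_3(M,F)$, then $(N,F)$ is exact of first order; if for every extension with kernel $(N,F)$ it is exact at $K^J_3(N,F)$, then $(N,F)$ is exact of second order. 3. If $(N,F)$ is partially admissible on $N\cap[M,F]$, the sequence splits at $K^J_2(P,E)$: there is a projection of $K^J_2(P,E)$ onto the image of $K^J_2(M,F)$. -/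

import Mathlib

universe u

open scoped commutatorElement

/-! ### The normalized free cover of a group -/

/-- `U_F`: the free group on symbols `u_x`, `x ∈ F`, normalized by `u_1 = 1`; that is, the free
group on the nontrivial elements of `F`. -/
abbrev UGrp (F : Type u) [Group F] : Type u := FreeGroup {x : F // x ≠ 1}

namespace UGrp

variable {F G H : Type u} [Group F] [Group G] [Group H]

open Classical in
/-- The element `u_x` of `U_F`, with `u_1 = 1`. -/
noncomputable def u (x : F) : UGrp F := if h : x = 1 then 1 else FreeGroup.of ⟨x, h⟩

theorem u_one : u (1 : F) = 1 := by simp [u]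

/-- The evaluation `U_F → F`, `u_x ↦ x`. -/
noncomputable def ev : UGrp F →* F := FreeGroup.lift fun x => x.1

/-- The homomorphism `U_F → U_G`, `u_x ↦ u_{φ x}`, induced by `φ : F → G`. -/
noncomputable def map (φ : F →* G) : UGrp F →* UGrp G := FreeGroup.lift fun x => u (φ x.1)

theorem ev_u (x : F) : ev (u x) = x := by
  by_cases h : x = 1
  · simp [u, h]
  · simp [u, h, ev]

theorem map_u (φ : F →* G) (x : F) : map φ (u x) = u (φ x) := by
  by_cases h : x = 1
  · simp [h, u_one]
  · rw [u, dif_neg h, map, FreeGroup.lift_apply_of]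

theorem map_comp (ψ : G →* H) (φ : F →* G) : (map ψ).comp (map φ) = map (ψ.comp φ) := by
  apply FreeGroup.ext_hom
  intro x
  simp only [MonoidHom.comp_apply]
  rw [map, map, map, FreeGroup.lift_apply_of, FreeGroup.lift_apply_of]
  exact map_u ψ _

theorem map_map (ψ : G →* H) (φ : F →* G) (w : UGrp F) :
    map ψ (map φ w) = map (ψ.comp φ) w := DFunLike.congr_fun (map_comp ψ φ) w

theorem ev_map (φ : F →* G) (w : UGrp F) : ev (map φ w) = φ (ev w) := by
  have : ev.comp (map φ) = φ.comp ev := by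
    apply FreeGroup.ext_hom
    intro x
    simp only [MonoidHom.comp_apply]
    rw [map, FreeGroup.lift_apply_of, ev_u, ev, FreeGroup.lift_apply_of]
  exact DFunLike.congr_fun this w

end UGrp

/-! ### Normal pairs -/

/-- A normal pair `(N, F)`: a group `F` (the field `G`) with a normal subgroup `N`. -/
structure NormalPair : Type (u + 1) where
  G : Type u
  [group : Group G]
  N : Subgroup G
  [normal : N.Normal]

namespace NormalPair

attribute [instance] NormalPair.group NormalPair.normal

/-- A morphism of normal pairs `(N, F) → (M, G)`: a homomorphism `F → G` that maps `N` to `M`. -/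
structure Hom (A B : NormalPair.{u}) : Type u where
  toHom : A.G →* B.G
  mem : ∀ x ∈ A.N, toHom x ∈ B.N

/-- `U_{N,F}`, the kernel of `U_F → U_{F/N}`. -/
noncomputable def V (A : NormalPair.{u}) : Subgroup (UGrp A.G) :=
  (UGrp.map (QuotientGroup.mk' A.N)).ker

/-- `J_F`, the kernel of the evaluation `U_F → F`. -/
noncomputable def R (A : NormalPair.{u}) : Subgroup (UGrp A.G) := (UGrp.ev (F := A.G)).ker

/-- `J_{N,F}`, the kernel of the evaluation `U_{N,F} → N`. -/
noncomputable def J (A : NormalPair.{u}) : Subgroup (UGrp A.G) := A.V ⊓ A.R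

instance (A : NormalPair.{u}) : A.V.Normal := by unfold V; infer_instance
instance (A : NormalPair.{u}) : A.R.Normal := by unfold R; infer_instance
instance (A : NormalPair.{u}) : A.J.Normal := by unfold J; infer_instance

/-- The subgroup `[J_{N,F}, U_F] + [U_{N,F}, J_F]` of trivial elements. -/
noncomputable def T (A : NormalPair.{u}) : Subgroup (UGrp A.G) := ⁅A.J, ⊤⁆ ⊔ ⁅A.V, A.R⁆

instance (A : NormalPair.{u}) : A.T.Normal := by unfold T; infer_instance

/-- The subgroup `J_{N,F} ∩ [U_{N,F}, U_F]`. -/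
noncomputable def Z (A : NormalPair.{u}) : Subgroup (UGrp A.G) := A.J ⊓ ⁅A.V, ⊤⁆

/-- `K^J_2(N,F) = (J_{N,F} ∩ [U_{N,F}, U_F]) / ([J_{N,F}, U_F] + [U_{N,F}, J_F])`. -/
def K2 (A : NormalPair.{u}) : Type u := ↥A.Z ⧸ A.T.subgroupOf A.Z

/-- `K_1(N,F) = N / [N,F]`. -/
def K1 (A : NormalPair.{u}) : Type u := ↥A.N ⧸ (⁅A.N, (⊤ : Subgroup A.G)⁆).subgroupOf A.N

noncomputable instance (A : NormalPair.{u}) : CommGroup A.K2 :=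
  { (inferInstanceAs (Group (↥A.Z ⧸ A.T.subgroupOf A.Z)) : Group A.K2) with
    mul_comm := by
      intro a b
      induction a using QuotientGroup.induction_on with
      | H a =>
      induction b using QuotientGroup.induction_on with
      | H b =>
      refine QuotientGroup.eq.mpr ?_
      rw [Subgroup.mem_subgroupOf]
      have h : ⁅((b : UGrp A.G))⁻¹, ((a : UGrp A.G))⁻¹⁆ ∈ A.T :=
        (le_sup_left : ⁅A.J, ⊤⁆ ≤ A.T)
          (Subgroup.commutator_mem_commutator (A.J.inv_mem b.2.1) (Subgroup.mem_top _))
      simpa [commutatorElement_def, mul_assoc] using h }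

noncomputable instance (A : NormalPair.{u}) : CommGroup A.K1 :=
  { (inferInstanceAs (Group (↥A.N ⧸ (⁅A.N, (⊤ : Subgroup A.G)⁆).subgroupOf A.N)) :
      Group A.K1) with
    mul_comm := by
      intro a b
      induction a using QuotientGroup.induction_on with
      | H a =>
      induction b using QuotientGroup.induction_on with
      | H b =>
      refine QuotientGroup.eq.mpr ?_
      rw [Subgroup.mem_subgroupOf]
      have h : ⁅((b : A.G))⁻¹, ((a : A.G))⁻¹⁆ ∈ ⁅A.N, (⊤ : Subgroup A.G)⁆ :=
        Subgroup.commutator_mem_commutator (A.N.inv_mem b.2) (Subgroup.mem_top _)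
      simpa [commutatorElement_def, mul_assoc] using h }

/-- The class in `K^J_2(N,F)` of an element of `J_{N,F} ∩ [U_{N,F}, U_F]`. -/
noncomputable def K2.mk (A : NormalPair.{u}) : ↥A.Z →* A.K2 := QuotientGroup.mk' _

/-- The class in `K_1(N,F)` of an element of `N`. -/
noncomputable def K1.mk (A : NormalPair.{u}) : ↥A.N →* A.K1 := QuotientGroup.mk' _

/-! ### Functoriality -/

theorem Hom.map_V {A B : NormalPair.{u}} (f : Hom A B) : A.V ≤ B.V.comap (UGrp.map f.toHom) := by
  intro w hw
  have hw' : UGrp.map (QuotientGroup.mk' A.N) w = 1 := hw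
  change UGrp.map (QuotientGroup.mk' B.N) (UGrp.map f.toHom w) = 1
  have hc : (QuotientGroup.mk' B.N).comp f.toHom =
      (QuotientGroup.map A.N B.N f.toHom f.mem).comp (QuotientGroup.mk' A.N) := rfl
  rw [UGrp.map_map, hc, ← UGrp.map_map, hw', map_one]

theorem Hom.map_R {A B : NormalPair.{u}} (f : Hom A B) : A.R ≤ B.R.comap (UGrp.map f.toHom) := by
  intro w hw
  have hw' : UGrp.ev w = 1 := hw
  change UGrp.ev (UGrp.map f.toHom w) = 1
  rw [UGrp.ev_map, hw', map_one]

theorem Hom.map_J {A B : NormalPair.{u}} (f : Hom A B) : A.J ≤ B.J.comap (UGrp.map f.toHom) :=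
  fun _ hw => ⟨f.map_V hw.1, f.map_R hw.2⟩

theorem Hom.map_commutator {G H : Type u} [Group G] [Group H] (φ : G →* H) {K L : Subgroup G}
    {K' L' : Subgroup H} (hK : K ≤ K'.comap φ) (hL : L ≤ L'.comap φ) :
    ⁅K, L⁆ ≤ ⁅K', L'⁆.comap φ := by
  rw [← Subgroup.map_le_iff_le_comap, Subgroup.map_commutator]
  exact Subgroup.commutator_mono (Subgroup.map_le_iff_le_comap.mpr hK)
    (Subgroup.map_le_iff_le_comap.mpr hL)

theorem Hom.map_T {A B : NormalPair.{u}} (f : Hom A B) : A.T ≤ B.T.comap (UGrp.map f.toHom) :=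
  sup_le
    ((Hom.map_commutator _ f.map_J (fun _ _ => Subgroup.mem_top _)).trans
      (Subgroup.comap_mono le_sup_left))
    ((Hom.map_commutator _ f.map_V f.map_R).trans (Subgroup.comap_mono le_sup_right))

theorem Hom.map_Z {A B : NormalPair.{u}} (f : Hom A B) : A.Z ≤ B.Z.comap (UGrp.map f.toHom) :=
  fun _ hw => ⟨f.map_J hw.1,
    Hom.map_commutator _ f.map_V (fun _ _ => Subgroup.mem_top _) hw.2⟩

/-- The map on `K^J_2` induced by a morphism of normal pairs. -/
noncomputable def K2.map {A B : NormalPair.{u}} (f : Hom A B) : A.K2 →* B.K2 :=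
  QuotientGroup.map (A.T.subgroupOf A.Z) (B.T.subgroupOf B.Z)
    (((UGrp.map f.toHom).comp A.Z.subtype).codRestrict B.Z fun w => f.map_Z w.2)
    fun _ hw => f.map_T hw

/-- The map on `K_1` induced by a morphism of normal pairs. -/
noncomputable def K1.map {A B : NormalPair.{u}} (f : Hom A B) : A.K1 →* B.K1 :=
  QuotientGroup.map ((⁅A.N, (⊤ : Subgroup A.G)⁆).subgroupOf A.N)
    ((⁅B.N, (⊤ : Subgroup B.G)⁆).subgroupOf B.N)
    ((f.toHom.comp A.N.subtype).codRestrict B.N fun x => f.mem x.1 x.2)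
    fun _ hx => Hom.map_commutator f.toHom f.mem (fun _ _ => Subgroup.mem_top _) hx

/-! ### Suspensions and the higher groups -/

/-- The `J`-suspension `(J_{N,F}, U_F)`. -/
noncomputable def susp (A : NormalPair.{u}) : NormalPair.{u} := ⟨UGrp A.G, A.J⟩

/-- The morphism of suspensions induced by a morphism of pairs. -/
noncomputable def Hom.susp {A B : NormalPair.{u}} (f : Hom A B) :
    Hom (NormalPair.susp A) (NormalPair.susp B) :=
  ⟨UGrp.map f.toHom, f.map_J⟩

/-- The iterated suspension `(J^k_{N,F}, U^k_F)`. -/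
noncomputable def iterSusp : ℕ → NormalPair.{u} → NormalPair.{u}
  | 0, A => A
  | k + 1, A => susp (iterSusp k A)

/-- The morphism `(J^k_{N,F}, U^k_F) → (J^k_{M,G}, U^k_G)` induced by `(N,F) → (M,G)`. -/
noncomputable def Hom.iterSusp {A B : NormalPair.{u}} (f : Hom A B) :
    (k : ℕ) → Hom (NormalPair.iterSusp k A) (NormalPair.iterSusp k B)
  | 0 => f
  | k + 1 => Hom.susp (Hom.iterSusp f k)

/-- `KJ k A` is `K^J_{k+2}(N,F) = K^J_2(J^k_{N,F}, U^k_F)`; in particular `KJ 0 A = K2 A`. -/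
abbrev KJ (k : ℕ) (A : NormalPair.{u}) : Type u := K2 (iterSusp k A)

/-- The map on `K^J_{k+2}` induced by a morphism of normal pairs. -/
noncomputable abbrev KJ.map (k : ℕ) {A B : NormalPair.{u}} (f : Hom A B) : KJ k A →* KJ k B :=
  K2.map (f.iterSusp k)

/-! ### Exactness of first and second order -/

/-- The pair `(J_{E/P}, F̄)` derived from `(P,E)`, where `F̄ = U_E / J_{P,E} ≃ P ⋊ U_{E/P}` and
`J_{E/P}` is the image of `J_E` in `F̄`. -/
noncomputable def derived (C : NormalPair.{u}) : NormalPair.{u} :=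
  ⟨UGrp C.G ⧸ C.J, C.R.map (QuotientGroup.mk' C.J)⟩

/-- The pair `(J_{E/P} × P, F̄)`: here `P` is the image of `U_{P,E}` in `F̄ = U_E / J_{P,E}`, so
`J_{E/P} × P` is the image of the product of `J_E` and `U_{P,E}`. -/
noncomputable def derivedProd (C : NormalPair.{u}) : NormalPair.{u} :=
  ⟨UGrp C.G ⧸ C.J, (C.R ⊔ C.V).map (QuotientGroup.mk' C.J)⟩

/-- The inclusion `(J_{E/P}, F̄) ⊆ (J_{E/P} × P, F̄)`. -/
noncomputable def derivedIncl (C : NormalPair.{u}) : Hom C.derived C.derivedProd :=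
  ⟨MonoidHom.id (UGrp C.G ⧸ C.J), fun _ hx => Subgroup.map_mono le_sup_left hx⟩

/-- `(P,E)` is exact of first order: `K^J_2(J_{E/P}, F̄) → K^J_2(J_{E/P} × P, F̄)` is injective. -/
def ExactFirst (C : NormalPair.{u}) : Prop := Function.Injective (K2.map C.derivedIncl)

/-- `(P,E)` is exact of second order: its derived pair `(J_{E/P}, F̄)` is exact of first order. -/
def ExactSecond (C : NormalPair.{u}) : Prop := C.derived.ExactFirst

/-- `(P,E)` is fully exact: exact of first and of second order. -/
def FullyExact (C : NormalPair.{u}) : Prop := C.ExactFirst ∧ C.ExactSecond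

/-! ### Partial admissibility -/

/-- Let `[N,F] ≤ N₀ ≤ N`. The canonical `F`-central extension of `N` is the image `U_{N,F} / T` of
`U_{N,F}` in `U_F / T`, where `T = [J_{N,F}, U_F] + [U_{N,F}, J_F]`; the group `F` acts on it
through conjugation by `U_F`. The pair `(N,F)` is partially admissible on `N₀` if this extension
contains an `F`-normal subgroup `X`, containing the canonical commutator subgroup
`[U_{N,F}, U_F] / T`, that is an extension of `N₀` by `K^J_2(N,F)`. -/
def PartiallyAdmissible (A : NormalPair.{u}) (N₀ : Subgroup A.G) : Prop :=
  ∃ X : Subgroup (UGrp A.G ⧸ A.T),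
    X.Normal ∧
    X ≤ A.V.map (QuotientGroup.mk' A.T) ∧
    (⁅A.V, (⊤ : Subgroup (UGrp A.G))⁆).map (QuotientGroup.mk' A.T) ≤ X ∧
    X ⊓ A.J.map (QuotientGroup.mk' A.T) = A.Z.map (QuotientGroup.mk' A.T) ∧
    (X.comap (QuotientGroup.mk' A.T)).map UGrp.ev = N₀

/-! ### Extensions of normal pairs, mapping cones and boundary maps -/

/-- `1 → (N,F) → (M,F) → (P,E) → 1` is an extension of normal pairs: the first morphism identifies
the ambient groups, the second is surjective on the ambient groups with kernel `N`, and it maps `M`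
onto `P`. -/
structure IsExtension {A B C : NormalPair.{u}} (i : Hom A B) (p : Hom B C) : Prop where
  bijective : Function.Bijective i.toHom
  surjective : Function.Surjective p.toHom
  ker_eq : p.toHom.ker = A.N.map i.toHom
  map_eq : B.N.map p.toHom = C.N

/-- The ambient group `F ×_φ U_G` of the mapping cone of `φ : (N,F) → (M,G)`. -/
noncomputable def coneGroup {A B : NormalPair.{u}} (f : Hom A B) : Subgroup (A.G × UGrp B.G) :=
  MonoidHom.eqLocus (f.toHom.comp (MonoidHom.fst A.G (UGrp B.G)))
    (UGrp.ev.comp (MonoidHom.snd A.G (UGrp B.G)))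

/-- The mapping cone `(N ×_φ U_{M,G}, F ×_φ U_G)` of a morphism `φ : (N,F) → (M,G)`. -/
noncomputable def cone {A B : NormalPair.{u}} (f : Hom A B) : NormalPair.{u} :=
  ⟨↥(coneGroup f), (A.N.prod B.V).subgroupOf (coneGroup f)⟩

/-- The projection `(C_φ, U_φ) → (N,F)`. -/
noncomputable def coneFst {A B : NormalPair.{u}} (f : Hom A B) : Hom (cone f) A :=
  ⟨(MonoidHom.fst A.G (UGrp B.G)).comp (coneGroup f).subtype, fun _ hx => hx.1⟩

/-- The morphism `(C_i, U_i) → (J_{P,E}, U_E)` induced by `U_F → U_E`, for `(N,F) → (M,F) → (P,E)`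
such that the composition is trivial on `N`. -/
noncomputable def coneToSusp {A B C : NormalPair.{u}} (i : Hom A B) (p : Hom B C)
    (h : ∀ x ∈ A.N, p.toHom (i.toHom x) = 1) : Hom (cone i) (susp C) :=
  ⟨((UGrp.map p.toHom).comp (MonoidHom.snd A.G (UGrp B.G))).comp (coneGroup i).subtype, by
    intro x hx
    refine ⟨p.map_V hx.2, ?_⟩
    have hx' : i.toHom x.1.1 = UGrp.ev x.1.2 := x.2
    change UGrp.ev (UGrp.map p.toHom x.1.2) = 1
    rw [UGrp.ev_map, ← hx']
    exact h _ hx.1⟩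

theorem susp_comp_eq_one {A B C : NormalPair.{u}} (i : Hom A B) (p : Hom B C)
    (h : ∀ x ∈ A.N, p.toHom (i.toHom x) = 1) :
    ∀ w ∈ (susp A).N, p.susp.toHom (i.susp.toHom w) = 1 := by
  intro w hw
  have hw' : UGrp.map (QuotientGroup.mk' A.N) w = 1 := hw.1
  have hc : p.toHom.comp i.toHom =
      (QuotientGroup.lift A.N (p.toHom.comp i.toHom) h).comp (QuotientGroup.mk' A.N) := rfl
  have key : UGrp.map p.toHom (UGrp.map i.toHom (show UGrp A.G from w)) = 1 := by
    rw [UGrp.map_map, hc, ← UGrp.map_map]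
    exact (congrArg _ hw').trans (map_one _)
  exact key

theorem iterSusp_comp_eq_one {A B C : NormalPair.{u}} (i : Hom A B) (p : Hom B C)
    (h : ∀ x ∈ A.N, p.toHom (i.toHom x) = 1) (k : ℕ) :
    ∀ w ∈ (iterSusp k A).N, (p.iterSusp k).toHom ((i.iterSusp k).toHom w) = 1 := by
  induction k with
  | zero => exact h
  | succ k ih => exact susp_comp_eq_one _ _ ih

theorem IsExtension.comp_eq_one {A B C : NormalPair.{u}} {i : Hom A B} {p : Hom B C}
    (h : IsExtension i p) : ∀ x ∈ A.N, p.toHom (i.toHom x) = 1 := by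
  intro x hx
  have : i.toHom x ∈ p.toHom.ker := h.ker_eq ▸ Subgroup.mem_map_of_mem _ hx
  exact this

/-- `δ : K^J_{k+3}(P,E) → K^J_{k+2}(N,F)` is the boundary map: with `(C, U)` the mapping cone of
`(J^k_{N,F}, U^k_F) → (J^k_{M,F}, U^k_F)`, the composition of `δ` with
`K^J_2(C, U) → K^J_2(J^{k+1}_{P,E}, U^{k+1}_E) = K^J_{k+3}(P,E)` is the map
`K^J_2(C, U) → K^J_2(J^k_{N,F}, U^k_F) = K^J_{k+2}(N,F)` induced by the projection. -/
def IsBoundary {A B C : NormalPair.{u}} {i : Hom A B} {p : Hom B C} (h : IsExtension i p) (k : ℕ)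
    (δ : KJ (k + 1) C →* KJ k A) : Prop :=
  ∀ x : K2 (cone (i.iterSusp k)),
    δ (K2.map (coneToSusp (i.iterSusp k) (p.iterSusp k)
        (iterSusp_comp_eq_one i p h.comp_eq_one k)) x) =
      K2.map (coneFst (i.iterSusp k)) x

/-- `δ : K^J_2(P,E) → K_1(N,F)` is the boundary map: if `w ∈ [U_{M,F}, U_F]` evaluates to `a ∈ N`
and maps to `y ∈ J_{P,E} ∩ [U_{P,E}, U_E]`, then `δ` maps the class of `y` to the class of `a`. -/
def IsBoundaryOne {A B C : NormalPair.{u}} (i : Hom A B) (p : Hom B C) (δ : K2 C →* K1 A) : Prop :=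
  ∀ (w : UGrp B.G) (a : ↥A.N) (y : ↥C.Z), w ∈ ⁅B.V, (⊤ : Subgroup (UGrp B.G))⁆ →
    UGrp.ev w = i.toHom a → UGrp.map p.toHom w = y → δ (K2.mk C y) = K1.mk A a

end NormalPair

open NormalPair

/-!
For a free group `F` the group `K^J_2(N,F)` is the third homology of `F/N`, so it depends on the
quotient only. Hence the boundary map `K^J_3(P,E) → K^J_2(N,F)` can be defined as
`K^J_2(J_{P,E}, U_E) → K^J_2(J_E, U_E) ≅ K^J_2(ev⁻¹ N, U_F) → K^J_2(N,F)`, and exactness of first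
and second order of `(N,F)` become exactness in the middle and injectivity of the first map of
`K^J_2(J_{N,F}, U_F) → K^J_2(J_F, U_F) → K^J_2(ev⁻¹ N, U_F)`. Moreover `K^J_n = 0` for `n ≥ 4`: over
`U_{J_{N,F}} → J_{N,F} → U_F`, a free group extended by a free group, every crossed module is
realised by a group extension. The projection of `K^J_2(P,E)` comes from a
retraction of `J_{M,F} / ([J_{M,F}, U_F] [U_{M,F}, J_F])` onto `K^J_2(M,F)`, which exists because
subgroups of free abelian groups are free.
-/

/-! ### Free groups and commutator subgroups -/

theorem exists_lift_of_isFreeGroup {G H K : Type*} [Group G] [Group H] [Group K] [IsFreeGroup G]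
    (f : H →* K) (g : G →* K) (h : ∀ x, ∃ y, f y = g x) : ∃ l : G →* H, ∀ x, f (l x) = g x := by
  choose c hc using h
  let l : G →* H := IsFreeGroup.lift fun a => c (IsFreeGroup.of a)
  have hl : f.comp l = g := IsFreeGroup.ext_hom fun a => by simp [l, hc]
  exact ⟨l, DFunLike.congr_fun hl⟩

theorem exists_section_of_isFreeGroup {G H : Type*} [Group G] [Group H] [IsFreeGroup H]
    {f : G →* H} (hf : Function.Surjective f) : ∃ s : H →* G, ∀ x, f (s x) = x :=
  exists_lift_of_isFreeGroup f (MonoidHom.id H) hf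

theorem isFreeGroup_of_disjoint_ker {G H : Type u} [Group G] [Group H] [IsFreeGroup H]
    (f : G →* H) {K : Subgroup G} (hK : Disjoint K f.ker) : IsFreeGroup K := by
  have hf : Function.Injective (f.comp K.subtype) := by
    rw [injective_iff_map_eq_one]
    exact fun x hx => Subtype.ext (Subgroup.disjoint_def.mp hK x.2 hx)
  exact IsFreeGroup.ofMulEquiv (MonoidHom.ofInjective hf).symm

theorem exists_factorization_of_ker_le {G H K : Type*} [Group G] [Group H] [Group K] {q : G →* H}
    (hq : Function.Surjective q) {r : G →* K} (h : q.ker ≤ r.ker) :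
    ∃ s : H →* K, ∀ x, s (q x) = r x :=
  ⟨q.liftOfSurjective hq ⟨r, h⟩, q.liftOfRightInverse_comp_apply _ _ ⟨r, h⟩⟩

theorem commutatorElement_mul_mul_of_commute {G : Type*} [Group G] {a b x y : G}
    (ha : ∀ g, Commute a g) (hb : Commute b x) (hb' : Commute b ⁅x, y⁆) :
    ⁅a * x, b * y⁆ = ⁅x, y⁆ :=
  calc ⁅a * x, b * y⁆ = a * (x * (b * y) * x⁻¹) * a⁻¹ * (b * y)⁻¹ := by
        rw [commutatorElement_def]; group
    _ = (x * b) * (y * x⁻¹ * y⁻¹) * b⁻¹ := by rw [(ha _).eq]; group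
    _ = b * ⁅x, y⁆ * b⁻¹ := by rw [← hb.eq, commutatorElement_def]; group
    _ = ⁅x, y⁆ := by rw [hb'.eq, mul_inv_cancel_right]

theorem mk'_commute_of_commutator_le {G : Type*} [Group G] {K L T : Subgroup G} [T.Normal]
    (h : ⁅K, L⁆ ≤ T) {k l : G} (hk : k ∈ K) (hl : l ∈ L) :
    Commute (QuotientGroup.mk' T k) (QuotientGroup.mk' T l) := by
  rw [← commutatorElement_eq_one_iff_commute, ← map_commutatorElement]
  exact (QuotientGroup.eq_one_iff _).mpr (h (Subgroup.commutator_mem_commutator hk hl))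

theorem eq_of_mem_commutator_of_commute {G H : Type*} [Group G] [Group H] {f g : G →* H}
    {K L : Subgroup G} [K.Normal] (hK : ∀ k ∈ K, ∀ x, Commute (f k * (g k)⁻¹) x)
    (hL : ∀ l ∈ L, ∀ k ∈ K, Commute (f l * (g l)⁻¹) (g k)) {w : G} (hw : w ∈ ⁅K, L⁆) :
    f w = g w := by
  suffices ⁅K, L⁆ ≤ f.eqLocus g from this hw
  rw [Subgroup.commutator_le]
  intro k hk l hl
  have hkl : ⁅k, l⁆ ∈ K :=
    Subgroup.commutator_le_left K L (Subgroup.commutator_mem_commutator hk hl)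
  have key := commutatorElement_mul_mul_of_commute (y := g l) (hK k hk) (hL l hl k hk)
    (map_commutatorElement g k l ▸ hL l hl _ hkl)
  rw [inv_mul_cancel_right, inv_mul_cancel_right] at key
  exact (map_commutatorElement f k l).trans (key.trans (map_commutatorElement g k l).symm)

/-- With `s` a section of `f`, the homomorphisms `mk` and `mk ∘ s ∘ f` to `G / [ker f, G]` differ
by central elements, so they agree on commutators. -/
theorem ker_inf_commutator_le_of_section {G H : Type*} [Group G] [Group H] {f : G →* H}
    {s : H →* G} (hs : ∀ x, f (s x) = x) : f.ker ⊓ ⁅(⊤ : Subgroup G), ⊤⁆ ≤ ⁅f.ker, ⊤⁆ := by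
  rintro w ⟨hw, hw'⟩
  let mk := QuotientGroup.mk' ⁅f.ker, (⊤ : Subgroup G)⁆
  have hc : ∀ x g, Commute (mk x * (mk (s (f x)))⁻¹) g := by
    intro x g
    obtain ⟨g, rfl⟩ := QuotientGroup.mk'_surjective _ g
    rw [← map_inv, ← map_mul]
    exact mk'_commute_of_commutator_le le_rfl (by simp [MonoidHom.mem_ker, hs])
      (Subgroup.mem_top g)
  have key : mk w = mk (s (f w)) := eq_of_mem_commutator_of_commute
    (g := mk.comp (s.comp f)) (fun k _ x => hc k x) (fun l _ k _ => hc l _) hw'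
  rw [MonoidHom.mem_ker.mp hw, map_one, map_one] at key
  exact (QuotientGroup.eq_one_iff w).mp key

/-! ### The free cover -/

namespace UGrp

variable {F G H : Type u} [Group F] [Group G] [Group H]

theorem ev_surjective : Function.Surjective (ev : UGrp F →* F) := fun x => ⟨u x, ev_u x⟩

theorem hom_ext {H : Type*} [Group H] {f g : UGrp F →* H} (h : ∀ x, f (u x) = g (u x)) :
    f = g := by
  apply FreeGroup.ext_hom
  rintro ⟨x, hx⟩
  have := h x
  rwa [u, dif_neg hx] at this

theorem map_id : map (MonoidHom.id F) = MonoidHom.id (UGrp F) :=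
  hom_ext fun x => map_u _ x

theorem map_surjective {φ : F →* G} (h : Function.Surjective φ) :
    Function.Surjective (map φ) := by
  rw [← MonoidHom.range_eq_top, eq_top_iff, ← FreeGroup.closure_range_of, Subgroup.closure_le]
  rintro _ ⟨x, rfl⟩
  obtain ⟨y, hy⟩ := h x.1
  exact ⟨u y, by rw [map_u, hy, u, dif_neg x.2]⟩

theorem map_injective {φ : F →* G} (h : Function.Injective φ) : Function.Injective (map φ) := by
  have : map φ = FreeGroup.map fun x : {x : F // x ≠ 1} =>
      (⟨φ x.1, fun e => x.2 (h (e.trans (map_one φ).symm))⟩ : {y : G // y ≠ 1}) := by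
    apply FreeGroup.ext_hom
    intro x
    rw [map, FreeGroup.lift_apply_of, FreeGroup.map.of, u, dif_neg]
  rw [this]
  exact FreeGroup.map_injective fun x y e => Subtype.ext (h (congrArg Subtype.val e))

theorem ker_map_le {φ : F →* G} {ψ : F →* H} (h : φ.ker ≤ ψ.ker) :
    (map φ).ker ≤ (map ψ).ker := by
  intro w hw
  have hw' : map (QuotientGroup.mk' φ.ker) w = 1 := by
    apply map_injective (QuotientGroup.kerLift_injective φ)
    rw [map_map, map_one]
    exact hw
  have hψ : ψ = (QuotientGroup.lift φ.ker ψ h).comp (QuotientGroup.mk' φ.ker) := rfl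
  rw [MonoidHom.mem_ker, hψ, ← map_map, hw', map_one]

theorem ker_map_congr {φ : F →* G} {ψ : F →* H} (h : φ.ker = ψ.ker) :
    (map φ).ker = (map ψ).ker :=
  le_antisymm (ker_map_le h.le) (ker_map_le h.ge)

theorem exists_section {p : G →* H} {q : UGrp H →* G} (hpq : ∀ w, p (q w) = ev w) :
    ∃ σ : UGrp H →* UGrp G, (∀ w, ev (σ w) = q w) ∧ ∀ w, map p (σ w) = w := by
  let σ : UGrp H →* UGrp G := FreeGroup.lift fun x => u (q (u x.1))
  have hσ (x : H) : σ (u x) = u (q (u x)) := by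
    by_cases hx : x = 1
    · rw [hx, u_one, map_one, map_one, u_one]
    · conv_lhs => rw [u, dif_neg hx]
      exact FreeGroup.lift_apply_of
  have hev : ev.comp σ = q := hom_ext fun x => by rw [MonoidHom.comp_apply, hσ, ev_u]
  have hmap : (map p).comp σ = MonoidHom.id _ := hom_ext fun x => by
    rw [MonoidHom.comp_apply, hσ, map_u, hpq, ev_u, MonoidHom.id_apply]
  exact ⟨σ, DFunLike.congr_fun hev, DFunLike.congr_fun hmap⟩

end UGrp

namespace NormalPair

variable {A B C : NormalPair.{u}}

/-! ### The subgroups `V`, `R`, `J`, `T` -/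

theorem mem_V_iff {w : UGrp A.G} : w ∈ A.V ↔ UGrp.map (QuotientGroup.mk' A.N) w = 1 := Iff.rfl

theorem mem_R_iff {w : UGrp A.G} : w ∈ A.R ↔ UGrp.ev w = 1 := Iff.rfl

theorem ker_map_eq_V {H : Type u} [Group H] {f : A.G →* H} (h : f.ker = A.N) :
    (UGrp.map f).ker = A.V :=
  UGrp.ker_map_congr (h.trans (QuotientGroup.ker_mk' A.N).symm)

theorem V_le_ker_map {H : Type u} [Group H] {f : A.G →* H} (h : A.N ≤ f.ker) :
    A.V ≤ (UGrp.map f).ker :=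
  UGrp.ker_map_le ((QuotientGroup.ker_mk' A.N).trans_le h)

theorem commutator_V_le : ⁅A.V, (⊤ : Subgroup (UGrp A.G))⁆ ≤ A.V := Subgroup.commutator_le_left _ _

theorem commutator_J_le_T : ⁅A.J, (⊤ : Subgroup (UGrp A.G))⁆ ≤ A.T := le_sup_left

theorem commutator_V_R_le_T : ⁅A.V, A.R⁆ ≤ A.T := le_sup_right

theorem T_le_commutator : A.T ≤ ⁅A.V, (⊤ : Subgroup (UGrp A.G))⁆ :=
  sup_le (Subgroup.commutator_mono inf_le_left le_rfl) (Subgroup.commutator_mono le_rfl le_top)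

theorem T_le_J : A.T ≤ A.J :=
  sup_le (Subgroup.commutator_le_left _ _)
    (le_inf (Subgroup.commutator_le_left _ _) (Subgroup.commutator_le_right _ _))

theorem T_le_Z : A.T ≤ A.Z := le_inf T_le_J T_le_commutator

theorem mem_Z_of_mem_commutator {w : UGrp A.G} (hw : w ∈ ⁅A.V, (⊤ : Subgroup (UGrp A.G))⁆)
    (h : UGrp.ev w = 1) : w ∈ A.Z :=
  ⟨⟨commutator_V_le hw, h⟩, hw⟩

theorem mk'_J_commute {j : UGrp A.G} (hj : j ∈ A.J) (g : UGrp A.G ⧸ A.T) :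
    Commute (QuotientGroup.mk' A.T j) g := by
  obtain ⟨g, rfl⟩ := QuotientGroup.mk'_surjective _ g
  exact mk'_commute_of_commutator_le commutator_J_le_T hj (Subgroup.mem_top _)

theorem mk'_R_commute {r v : UGrp A.G} (hr : r ∈ A.R) (hv : v ∈ A.V) :
    Commute (QuotientGroup.mk' A.T r) (QuotientGroup.mk' A.T v) :=
  (mk'_commute_of_commutator_le commutator_V_R_le_T hv hr).symm

theorem u_mem_V {x : A.G} (hx : x ∈ A.N) : UGrp.u x ∈ A.V := by
  rw [mem_V_iff, UGrp.map_u, QuotientGroup.mk'_apply, (QuotientGroup.eq_one_iff x).mpr hx,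
    UGrp.u_one]

theorem ev_mem_of_mem_V {w : UGrp A.G} (hw : w ∈ A.V) : UGrp.ev w ∈ A.N := by
  have : QuotientGroup.mk' A.N (UGrp.ev w) = 1 := by
    rw [← UGrp.ev_map, mem_V_iff.mp hw, map_one]
  exact (QuotientGroup.eq_one_iff _).mp this

theorem map_ev_V (A : NormalPair.{u}) : A.V.map UGrp.ev = A.N :=
  le_antisymm (Subgroup.map_le_iff_le_comap.mpr fun _ => ev_mem_of_mem_V)
    fun x hx => ⟨UGrp.u x, u_mem_V hx, UGrp.ev_u x⟩

theorem map_ev_commutator (A : NormalPair.{u}) :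
    (⁅A.V, (⊤ : Subgroup (UGrp A.G))⁆).map UGrp.ev = ⁅A.N, (⊤ : Subgroup A.G)⁆ := by
  rw [Subgroup.map_commutator, map_ev_V, Subgroup.map_top_of_surjective _ UGrp.ev_surjective]

theorem R_sup_V (A : NormalPair.{u}) : A.R ⊔ A.V = A.N.comap UGrp.ev := by
  rw [← map_ev_V, Subgroup.comap_map_eq, sup_comm]
  rfl

theorem Hom.map_commutator_V (f : Hom A B) {w : UGrp A.G}
    (hw : w ∈ ⁅A.V, (⊤ : Subgroup (UGrp A.G))⁆) :
    UGrp.map f.toHom w ∈ ⁅B.V, (⊤ : Subgroup (UGrp B.G))⁆ :=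
  Hom.map_commutator _ f.map_V (fun _ _ => Subgroup.mem_top _) hw

/-! ### Functoriality of `K1` and `K2` -/

/-- Composition of morphisms of normal pairs. -/
def Hom.comp (g : Hom B C) (f : Hom A B) : Hom A C :=
  ⟨g.toHom.comp f.toHom, fun x hx => g.mem _ (f.mem x hx)⟩

theorem Hom.ext {f g : Hom A B} (h : ∀ x, f.toHom x = g.toHom x) : f = g := by
  cases f
  cases g
  congr
  exact MonoidHom.ext h

theorem Hom.exists_inverse {f : Hom A B} (hf : Function.Bijective f.toHom)
    (hN : ∀ x, f.toHom x ∈ B.N → x ∈ A.N) : ∃ g : Hom B A,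
      Function.LeftInverse g.toHom f.toHom ∧ Function.RightInverse g.toHom f.toHom := by
  let e := MulEquiv.ofBijective f.toHom hf
  have he : ∀ y, f.toHom (e.symm y) = y := e.apply_symm_apply
  exact ⟨⟨e.symm.toMonoidHom, fun y hy => hN _ ((he y).symm ▸ hy)⟩, e.symm_apply_apply, he⟩

theorem K1.mk_surjective (A : NormalPair.{u}) : Function.Surjective (K1.mk A) :=
  QuotientGroup.mk'_surjective _

theorem K1.mk_eq_one_iff {a : A.N} : K1.mk A a = 1 ↔ (a : A.G) ∈ ⁅A.N, (⊤ : Subgroup A.G)⁆ :=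
  (QuotientGroup.eq_one_iff a).trans Subgroup.mem_subgroupOf

theorem K1.mk_eq_mk_iff {a b : A.N} :
    K1.mk A a = K1.mk A b ↔ (a : A.G) * (b : A.G)⁻¹ ∈ ⁅A.N, (⊤ : Subgroup A.G)⁆ := by
  rw [← div_eq_one, ← map_div, K1.mk_eq_one_iff, div_eq_mul_inv]
  rfl

theorem K1.map_mk (f : Hom A B) (a : A.N) :
    K1.map f (K1.mk A a) = K1.mk B ⟨f.toHom a, f.mem a a.2⟩ := rfl

theorem K1.map_mk_eq_one_iff {f : Hom A B} {a : A.N} :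
    K1.map f (K1.mk A a) = 1 ↔ f.toHom a ∈ ⁅B.N, (⊤ : Subgroup B.G)⁆ :=
  K1.mk_eq_one_iff

theorem K1.map_leftInverse {f : Hom A B} {g : Hom B A}
    (h : Function.LeftInverse g.toHom f.toHom) :
    Function.LeftInverse (K1.map g) (K1.map f) := by
  intro x
  obtain ⟨a, rfl⟩ := K1.mk_surjective A x
  rw [K1.map_mk, K1.map_mk]
  exact congrArg (K1.mk A) (Subtype.ext (h a))

theorem K1.map_injective_of_bijective {f : Hom A B} (hf : Function.Bijective f.toHom)
    (hN : ∀ x, f.toHom x ∈ B.N → x ∈ A.N) : Function.Injective (K1.map f) := by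
  obtain ⟨g, hg, -⟩ := Hom.exists_inverse hf hN
  exact (K1.map_leftInverse hg).injective

theorem K2.mk_surjective (A : NormalPair.{u}) : Function.Surjective (K2.mk A) :=
  QuotientGroup.mk'_surjective _

theorem K2.mk_eq_one_iff {z : A.Z} : K2.mk A z = 1 ↔ (z : UGrp A.G) ∈ A.T :=
  (QuotientGroup.eq_one_iff z).trans Subgroup.mem_subgroupOf

theorem K2.mk_eq_mk_iff {z z' : A.Z} :
    K2.mk A z = K2.mk A z' ↔ (z : UGrp A.G) * (z' : UGrp A.G)⁻¹ ∈ A.T := by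
  rw [← div_eq_one, ← map_div, K2.mk_eq_one_iff, div_eq_mul_inv]
  rfl

theorem K2.map_mk (f : Hom A B) (z : A.Z) :
    K2.map f (K2.mk A z) = K2.mk B ⟨UGrp.map f.toHom z, f.map_Z z.2⟩ := rfl

theorem K2.map_mk_eq_one_iff {f : Hom A B} {z : A.Z} :
    K2.map f (K2.mk A z) = 1 ↔ UGrp.map f.toHom (z : UGrp A.G) ∈ B.T :=
  K2.mk_eq_one_iff

theorem K2.map_comp (g : Hom B C) (f : Hom A B) (x : A.K2) :
    K2.map (g.comp f) x = K2.map g (K2.map f x) := by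
  obtain ⟨z, rfl⟩ := K2.mk_surjective A x
  simp only [K2.map_mk, UGrp.map_map]
  rfl

theorem K2.map_map_of_comm {B' : NormalPair.{u}} {f : Hom A B} {g : Hom B C} {f' : Hom A B'}
    {g' : Hom B' C} (h : ∀ x, g.toHom (f.toHom x) = g'.toHom (f'.toHom x)) (x : A.K2) :
    K2.map g (K2.map f x) = K2.map g' (K2.map f' x) := by
  rw [← K2.map_comp, ← K2.map_comp, Hom.ext (f := g.comp f) (g := g'.comp f') h]

theorem K2.map_leftInverse {f : Hom A B} {g : Hom B A}
    (h : Function.LeftInverse g.toHom f.toHom) :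
    Function.LeftInverse (K2.map g) (K2.map f) := by
  intro x
  obtain ⟨z, rfl⟩ := K2.mk_surjective A x
  have hgf : g.toHom.comp f.toHom = MonoidHom.id A.G := MonoidHom.ext h
  simp only [K2.map_mk, UGrp.map_map, hgf, UGrp.map_id, MonoidHom.id_apply]

theorem K2.map_bijective_of_bijective {f : Hom A B} (hf : Function.Bijective f.toHom)
    (hN : ∀ x, f.toHom x ∈ B.N → x ∈ A.N) : Function.Bijective (K2.map f) := by
  obtain ⟨g, hg, hg'⟩ := Hom.exists_inverse hf hN
  exact Function.bijective_iff_has_inverse.mpr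
    ⟨K2.map g, K2.map_leftInverse hg, K2.map_leftInverse hg'⟩

theorem K2.map_eq_one {f : Hom A B} (h : ∀ x ∈ A.N, f.toHom x = 1) (x : A.K2) :
    K2.map f x = 1 := by
  obtain ⟨z, rfl⟩ := K2.mk_surjective A x
  rw [K2.map_mk_eq_one_iff, MonoidHom.mem_ker.mp (V_le_ker_map h z.2.1.1)]
  exact one_mem _

/-! ### The exact sequence in low degrees -/

variable {i : Hom A B} {p : Hom B C}

namespace IsExtension

theorem exists_of_map_eq_one (h : IsExtension i p) {x : B.G} (hx : p.toHom x = 1) :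
    ∃ a ∈ A.N, i.toHom a = x := by
  have : x ∈ p.toHom.ker := hx
  rwa [h.ker_eq] at this

theorem mem_iff (h : IsExtension i p) {x : A.G} : x ∈ A.N ↔ p.toHom (i.toHom x) = 1 := by
  refine ⟨h.comp_eq_one x, fun hx => ?_⟩
  obtain ⟨a, ha, e⟩ := h.exists_of_map_eq_one hx
  rwa [← h.bijective.1 e]

theorem mem_iff_map_mem (h : IsExtension i p) {x : B.G} : x ∈ B.N ↔ p.toHom x ∈ C.N := by
  refine ⟨p.mem x, fun hx => ?_⟩
  rw [← h.map_eq] at hx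
  obtain ⟨y, hy, e⟩ := hx
  obtain ⟨a, ha, e'⟩ := h.exists_of_map_eq_one (x := x * y⁻¹) (by rw [map_mul, map_inv, e,
    mul_inv_cancel])
  rw [← inv_mul_cancel_right x y, ← e']
  exact mul_mem (i.mem a ha) hy

theorem mem_V_iff (h : IsExtension i p) {w : UGrp A.G} :
    w ∈ A.V ↔ UGrp.map p.toHom (UGrp.map i.toHom w) = 1 := by
  have hk : (p.toHom.comp i.toHom).ker = A.N := Subgroup.ext fun _ => h.mem_iff.symm
  rw [← ker_map_eq_V hk, MonoidHom.mem_ker, UGrp.map_map]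

theorem map_V_eq (h : IsExtension i p) : A.V.map (UGrp.map i.toHom) = (UGrp.map p.toHom).ker := by
  ext w
  obtain ⟨w, rfl⟩ := UGrp.map_surjective h.bijective.2 w
  rw [MonoidHom.mem_ker, ← h.mem_V_iff,
    Subgroup.mem_map_iff_mem (UGrp.map_injective h.bijective.1)]

theorem mem_V_iff_map_mem (h : IsExtension i p) {w : UGrp B.G} :
    w ∈ B.V ↔ UGrp.map p.toHom w ∈ C.V := by
  have hk : ((QuotientGroup.mk' C.N).comp p.toHom).ker = B.N := by
    rw [← MonoidHom.comap_ker, QuotientGroup.ker_mk']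
    exact Subgroup.ext fun _ => h.mem_iff_map_mem.symm
  rw [← ker_map_eq_V hk, MonoidHom.mem_ker, ← UGrp.map_map, NormalPair.mem_V_iff]

theorem map_map_V (h : IsExtension i p) : B.V.map (UGrp.map p.toHom) = C.V := by
  apply le_antisymm (Subgroup.map_le_iff_le_comap.mpr p.map_V)
  intro w hw
  obtain ⟨w, rfl⟩ := UGrp.map_surjective h.surjective w
  exact ⟨w, h.mem_V_iff_map_mem.mpr hw, rfl⟩

theorem map_map_R (h : IsExtension i p) : B.R.map (UGrp.map p.toHom) = C.R := by
  apply le_antisymm (Subgroup.map_le_iff_le_comap.mpr p.map_R)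
  intro w hw
  obtain ⟨w, rfl⟩ := UGrp.map_surjective h.surjective w
  have hw' : p.toHom (UGrp.ev w) = 1 := (UGrp.ev_map _ _).symm.trans hw
  refine ⟨w * (UGrp.u (UGrp.ev w))⁻¹, ?_, ?_⟩
  · rw [SetLike.mem_coe, mem_R_iff, map_mul, map_inv, UGrp.ev_u, mul_inv_cancel]
  · rw [map_mul, map_inv, UGrp.map_u, hw', UGrp.u_one, inv_one, mul_one]

theorem map_map_J (h : IsExtension i p) : B.J.map (UGrp.map p.toHom) = C.J := by
  apply le_antisymm (Subgroup.map_le_iff_le_comap.mpr p.map_J)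
  rintro w ⟨hV, hR⟩
  rw [SetLike.mem_coe, ← h.map_map_R] at hR
  obtain ⟨w, hw, rfl⟩ := hR
  exact ⟨w, ⟨h.mem_V_iff_map_mem.mpr hV, hw⟩, rfl⟩

theorem map_map_commutator (h : IsExtension i p) :
    (⁅B.V, (⊤ : Subgroup (UGrp B.G))⁆).map (UGrp.map p.toHom) =
      ⁅C.V, (⊤ : Subgroup (UGrp C.G))⁆ := by
  rw [Subgroup.map_commutator, h.map_map_V,
    Subgroup.map_top_of_surjective _ (UGrp.map_surjective h.surjective)]

theorem map_map_T (h : IsExtension i p) : B.T.map (UGrp.map p.toHom) = C.T := by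
  rw [T, T, Subgroup.map_sup, Subgroup.map_commutator, Subgroup.map_commutator, h.map_map_V,
    h.map_map_J, h.map_map_R,
    Subgroup.map_top_of_surjective _ (UGrp.map_surjective h.surjective)]

theorem mem_map_commutator (h : IsExtension i p) {w : UGrp B.G} (hw : UGrp.map p.toHom w = 1)
    (hw' : w ∈ ⁅B.V, (⊤ : Subgroup (UGrp B.G))⁆) :
    w ∈ (⁅A.V, (⊤ : Subgroup (UGrp A.G))⁆).map (UGrp.map i.toHom) := by
  obtain ⟨s, hs⟩ := exists_section_of_isFreeGroup (UGrp.map_surjective h.surjective)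
  rw [Subgroup.map_commutator, h.map_V_eq,
    Subgroup.map_top_of_surjective _ (UGrp.map_surjective h.bijective.2)]
  exact ker_inf_commutator_le_of_section hs ⟨hw, Subgroup.commutator_mono le_top le_rfl hw'⟩

theorem exists_mul_map_eq (h : IsExtension i p) {w : UGrp B.G}
    (hw : w ∈ ⁅B.V, (⊤ : Subgroup (UGrp B.G))⁆) (hT : UGrp.map p.toHom w ∈ C.T) :
    ∃ t ∈ B.T, ∃ z ∈ ⁅A.V, (⊤ : Subgroup (UGrp A.G))⁆, w = t * UGrp.map i.toHom z := by
  rw [← h.map_map_T] at hT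
  obtain ⟨t, ht, e⟩ := hT
  obtain ⟨z, hz, hz'⟩ := h.mem_map_commutator (w := t⁻¹ * w)
    (by rw [map_mul, map_inv, e, inv_mul_cancel]) (mul_mem (inv_mem (T_le_commutator ht)) hw)
  exact ⟨t, ht, z, hz, by rw [hz', mul_inv_cancel_left]⟩

theorem exact_K2 (h : IsExtension i p) : Function.MulExact (K2.map i) (K2.map p) := by
  intro y
  constructor
  · intro hy
    obtain ⟨⟨w, hw⟩, rfl⟩ := K2.mk_surjective B y
    obtain ⟨t, ht, z, hz, rfl⟩ := h.exists_mul_map_eq hw.2 (K2.map_mk_eq_one_iff.mp hy)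
    have hzR : UGrp.ev z = 1 := by
      have hw' : UGrp.ev (t * UGrp.map i.toHom z) = 1 := hw.1.2
      rw [map_mul, mem_R_iff.mp (T_le_J ht).2, one_mul, UGrp.ev_map] at hw'
      exact h.bijective.1 (hw'.trans (map_one _).symm)
    refine ⟨K2.mk A ⟨z, mem_Z_of_mem_commutator hz hzR⟩, K2.mk_eq_mk_iff.mpr ?_⟩
    change UGrp.map i.toHom z * (t * UGrp.map i.toHom z)⁻¹ ∈ B.T
    rw [mul_inv_rev, mul_inv_cancel_left]
    exact inv_mem ht
  · rintro ⟨x, rfl⟩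
    rw [← K2.map_comp]
    exact K2.map_eq_one h.comp_eq_one x

theorem exists_lift_Z (h : IsExtension i p) {y : UGrp C.G} (hy : y ∈ C.Z) :
    ∃ w ∈ ⁅B.V, (⊤ : Subgroup (UGrp B.G))⁆, UGrp.map p.toHom w = y ∧
      ∃ a ∈ A.N, UGrp.ev w = i.toHom a := by
  obtain ⟨w, hw, rfl⟩ := h.map_map_commutator.ge hy.2
  obtain ⟨a, ha, e⟩ := h.exists_of_map_eq_one ((UGrp.ev_map _ w).symm.trans hy.1.2)
  exact ⟨w, hw, rfl, a, ha, e.symm⟩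

theorem mem_commutator_of_map_mem_T (h : IsExtension i p) {w : UGrp B.G}
    (hw : w ∈ ⁅B.V, (⊤ : Subgroup (UGrp B.G))⁆) (hT : UGrp.map p.toHom w ∈ C.T) {a : A.G}
    (ha : UGrp.ev w = i.toHom a) : a ∈ ⁅A.N, (⊤ : Subgroup A.G)⁆ := by
  obtain ⟨t, ht, z, hz, rfl⟩ := h.exists_mul_map_eq hw hT
  rw [map_mul, mem_R_iff.mp (T_le_J ht).2, one_mul, UGrp.ev_map] at ha
  rw [← map_ev_commutator, ← h.bijective.1 ha]
  exact ⟨z, hz, rfl⟩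

theorem exists_boundaryOne (h : IsExtension i p) : ∃ δ : K2 C →* K1 A, IsBoundaryOne i p δ := by
  let e := MulEquiv.ofBijective i.toHom h.bijective
  have he : ∀ y, i.toHom (e.symm y) = y := e.apply_symm_apply
  let Y : Subgroup (UGrp B.G) := ⁅B.V, (⊤ : Subgroup (UGrp B.G))⁆ ⊓ C.Z.comap (UGrp.map p.toHom)
  let q : Y →* K2 C := (K2.mk C).comp
    (((UGrp.map p.toHom).comp Y.subtype).codRestrict C.Z fun w => w.2.2)
  have hq : Function.Surjective q := by
    intro x
    obtain ⟨⟨_, hy⟩, rfl⟩ := K2.mk_surjective C x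
    obtain ⟨w, hw, rfl, -⟩ := h.exists_lift_Z hy
    exact ⟨⟨w, hw, hy⟩, rfl⟩
  let r : Y →* K1 A := (K1.mk A).comp
    (((e.symm.toMonoidHom.comp UGrp.ev).comp Y.subtype).codRestrict A.N fun w => by
      change e.symm (UGrp.ev (w : UGrp B.G)) ∈ A.N
      rw [h.mem_iff, he, ← UGrp.ev_map]
      exact w.2.2.1.2)
  have hqr : q.ker ≤ r.ker := fun w hw => K1.mk_eq_one_iff.mpr
    (h.mem_commutator_of_map_mem_T w.2.1 (K2.mk_eq_one_iff.mp hw) (he _).symm)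
  obtain ⟨δ, hδ⟩ := exists_factorization_of_ker_le hq hqr
  refine ⟨δ, ?_⟩
  rintro w a ⟨_, hy⟩ hw hwa rfl
  have ha : e.symm (UGrp.ev w) = a := h.bijective.1 ((he _).trans hwa)
  exact (hδ ⟨w, hw, hy⟩).trans (congrArg (K1.mk A) (Subtype.ext ha))

theorem exact_K2_boundaryOne (h : IsExtension i p) {δ : K2 C →* K1 A} (hδ : IsBoundaryOne i p δ) :
    Function.MulExact (K2.map p) δ := by
  intro x
  constructor
  · intro hx
    obtain ⟨y, rfl⟩ := K2.mk_surjective C x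
    obtain ⟨w, hw, hwy, a, ha, e⟩ := h.exists_lift_Z y.2
    rw [hδ w ⟨a, ha⟩ y hw e hwy, K1.mk_eq_one_iff, ← map_ev_commutator] at hx
    obtain ⟨v, hv, rfl⟩ := hx
    have hwv : w * (UGrp.map i.toHom v)⁻¹ ∈ B.Z :=
      mem_Z_of_mem_commutator (mul_mem hw (inv_mem (i.map_commutator_V hv))) <| by
        rw [map_mul, map_inv, UGrp.ev_map, e, mul_inv_cancel]
    refine ⟨K2.mk B ⟨_, hwv⟩, (K2.map_mk _ _).trans (congrArg (K2.mk C) (Subtype.ext ?_))⟩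
    change UGrp.map p.toHom (w * (UGrp.map i.toHom v)⁻¹) = y
    rw [map_mul, map_inv, h.mem_V_iff.mp (commutator_V_le hv), inv_one, mul_one, hwy]
  · rintro ⟨z, rfl⟩
    obtain ⟨z, rfl⟩ := K2.mk_surjective B z
    have hz : UGrp.ev (z : UGrp B.G) = i.toHom (1 : A.N) := z.2.1.2.trans (map_one _).symm
    rw [K2.map_mk, hδ z 1 _ z.2.2 hz rfl, map_one]

theorem exact_boundaryOne_K1 (h : IsExtension i p) {δ : K2 C →* K1 A} (hδ : IsBoundaryOne i p δ) :
    Function.MulExact δ (K1.map i) := by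
  intro x
  constructor
  · intro hx
    obtain ⟨a, rfl⟩ := K1.mk_surjective A x
    rw [K1.map_mk_eq_one_iff, ← map_ev_commutator] at hx
    obtain ⟨w, hw, e⟩ := hx
    have hZ : UGrp.map p.toHom w ∈ C.Z := mem_Z_of_mem_commutator (p.map_commutator_V hw) <| by
      rw [UGrp.ev_map, e, h.comp_eq_one _ a.2]
    exact ⟨K2.mk C ⟨_, hZ⟩, hδ w a _ hw e rfl⟩
  · rintro ⟨y, rfl⟩
    obtain ⟨y, rfl⟩ := K2.mk_surjective C y
    obtain ⟨w, hw, hwy, a, ha, e⟩ := h.exists_lift_Z y.2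
    rw [hδ w ⟨a, ha⟩ y hw e hwy, K1.map_mk_eq_one_iff, ← map_ev_commutator]
    exact ⟨w, hw, e⟩

theorem exact_K1 (h : IsExtension i p) : Function.MulExact (K1.map i) (K1.map p) := by
  intro x
  obtain ⟨m, rfl⟩ := K1.mk_surjective B x
  constructor
  · intro hm
    rw [K1.map_mk_eq_one_iff, ← h.map_eq, ← Subgroup.map_top_of_surjective _ h.surjective,
      ← Subgroup.map_commutator] at hm
    obtain ⟨c, hc, e⟩ := hm
    obtain ⟨a, ha, e'⟩ := h.exists_of_map_eq_one (x := c⁻¹ * m)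
      (by rw [map_mul, map_inv, e, inv_mul_cancel])
    refine ⟨K1.mk A ⟨a, ha⟩, K1.mk_eq_mk_iff.mpr ?_⟩
    change i.toHom a * (m : B.G)⁻¹ ∈ _
    rw [e', mul_inv_cancel_right]
    exact inv_mem hc
  · rintro ⟨a, e⟩
    obtain ⟨a, rfl⟩ := K1.mk_surjective A a
    rw [← e, K1.map_mk, K1.map_mk_eq_one_iff]
    change p.toHom (i.toHom a) ∈ _
    rw [h.comp_eq_one _ a.2]
    exact one_mem _

theorem surjective_K1 (h : IsExtension i p) : Function.Surjective (K1.map p) := by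
  intro x
  obtain ⟨⟨c, hc⟩, rfl⟩ := K1.mk_surjective C x
  obtain ⟨m, hm, rfl⟩ := h.map_eq.ge hc
  exact ⟨K1.mk B ⟨m, hm⟩, rfl⟩

theorem boundaryOne_natural {A' B' C' : NormalPair.{u}} {i' : Hom A' B'} {p' : Hom B' C'}
    (h : IsExtension i p) {δ : K2 C →* K1 A} {δ' : K2 C' →* K1 A'} (hδ : IsBoundaryOne i p δ)
    (hδ' : IsBoundaryOne i' p' δ') (f : Hom A A') (g : Hom B B') (k : Hom C C')
    (hi : ∀ x, g.toHom (i.toHom x) = i'.toHom (f.toHom x))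
    (hp : ∀ x, k.toHom (p.toHom x) = p'.toHom (g.toHom x)) (x : K2 C) :
    K1.map f (δ x) = δ' (K2.map k x) := by
  obtain ⟨⟨_, hy⟩, rfl⟩ := K2.mk_surjective C x
  obtain ⟨w, hw, rfl, a, ha, e⟩ := h.exists_lift_Z hy
  rw [hδ w ⟨a, ha⟩ ⟨_, hy⟩ hw e rfl, K1.map_mk, K2.map_mk]
  refine (hδ' (UGrp.map g.toHom w) _ _ (g.map_commutator_V hw) ?_ ?_).symm
  · rw [UGrp.ev_map, e, hi]
  · have hkp : k.toHom.comp p.toHom = p'.toHom.comp g.toHom := MonoidHom.ext hp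
    change _ = UGrp.map k.toHom (UGrp.map p.toHom w)
    rw [UGrp.map_map, UGrp.map_map, hkp]

end IsExtension

end NormalPair

/-! ### Crossed modules realised by group extensions -/

/-- A group extension `E` realising the crossed module `d : M → U` with action `φ` over the image
of `π : E → U`: it contains `M` through `j`, the kernel of `π` lies in `M`, and conjugation by `E`
induces the given action on `M`. -/
structure RealizesCrossedModule {U M E : Type*} [Group U] [Group M] [Group E] (d : M →* U)
    (φ : U →* MulAut M) (j : M →* E) (π : E →* U) : Prop where
  injective : Function.Injective j
  map_eq : ∀ n, π (j n) = d n
  conj : ∀ e n, e * j n * e⁻¹ = j (φ (π e) n)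
  exists_of_map_eq_one : ∀ e, π e = 1 → ∃ n, j n = e

namespace RealizesCrossedModule

open SemidirectProduct

variable {U M E Q X : Type*} [Group U] [Group M] [Group E] [Group Q] [Group X] {d : M →* U}
  {φ : U →* MulAut M} {j : M →* E} {π : E →* U}

theorem refl (hpeiffer : ∀ n m, φ (d n) m = n * m * n⁻¹) :
    RealizesCrossedModule d φ (MonoidHom.id M) d :=
  ⟨Function.injective_id, fun _ => rfl, fun n m => (hpeiffer n m).symm, fun n _ => ⟨n, rfl⟩⟩

theorem exists_semidirectProduct (h : RealizesCrossedModule d φ j π) {κ : Q →* U}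
    {θ : Q →* MulAut E} (hθj : ∀ q n, θ q (j n) = j (φ (κ q) n))
    (hθπ : ∀ q e, π (θ q e) = κ q * π e * (κ q)⁻¹) (hκ : ∀ q, κ q ∈ π.range → q = 1) :
    ∃ ϖ : E ⋊[θ] Q →* U, (∀ e, ϖ e = π e.left * κ e.right) ∧
      RealizesCrossedModule d φ (inl.comp j) ϖ := by
  let ϖ : E ⋊[θ] Q →* U := SemidirectProduct.lift π κ fun q => MonoidHom.ext (hθπ q)
  have hϖ : ∀ e, ϖ e = π e.left * κ e.right := fun e => rfl
  refine ⟨ϖ, hϖ, inl_injective.comp h.injective, fun n => ?_, fun e n => ?_, fun e he => ?_⟩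
  · exact (lift_inl _ _ _ _).trans (h.map_eq n)
  · calc e * inl (j n) * e⁻¹
        = inl e.left * (inr e.right * inl (j n) * inr e.right⁻¹) * (inl e.left)⁻¹ := by
          conv_lhs => rw [← inl_left_mul_inr_right e]
          rw [map_inv]
          group
      _ = inl (j (φ (ϖ e) n)) := by
          rw [← inl_aut, hθj, ← map_inv, ← map_mul, ← map_mul, h.conj, hϖ, map_mul,
            MulAut.mul_apply]
  · rw [hϖ] at he
    have hq : e.right = 1 := hκ _ (eq_inv_of_mul_eq_one_right he ▸ inv_mem ⟨e.left, rfl⟩)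
    rw [hq, map_one, mul_one] at he
    obtain ⟨n, hn⟩ := h.exists_of_map_eq_one _ he
    exact ⟨n, SemidirectProduct.ext hn hq.symm⟩

theorem bijective_of_conj (h : RealizesCrossedModule d φ j π) (hφ : ∀ u n, d n = 1 → φ u n = n)
    (hπ : π.range.Normal) {u : U} {a : E →* E} (haj : ∀ n, a (j n) = j (φ u n))
    (haπ : ∀ e, π (a e) = u * π e * u⁻¹) : Function.Bijective a := by
  have ha : ∀ e, π e = 1 → a e = e := by
    intro e he
    obtain ⟨n, rfl⟩ := h.exists_of_map_eq_one e he
    rw [haj, hφ u n (by rw [← h.map_eq, he])]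
  constructor
  · rw [injective_iff_map_eq_one]
    intro e he
    have he' : u * π e * u⁻¹ = 1 := by rw [← haπ, he, map_one]
    rw [← ha e (conj_eq_one_iff.mp he'), he]
  · intro e
    obtain ⟨e', he'⟩ := hπ.conj_mem _ ⟨e, rfl⟩ u⁻¹
    refine ⟨e' * ((a e')⁻¹ * e), ?_⟩
    rw [map_mul, ha ((a e')⁻¹ * e), mul_inv_cancel_left]
    rw [map_mul, map_inv, haπ, he']
    group

theorem exists_mulAut_of_isFreeGroup [IsFreeGroup X] {ψ : X →* MulAut M} {π : M ⋊[ψ] X →* U}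
    (h : RealizesCrossedModule d φ inl π) (hd : ∀ u n, d (φ u n) = u * d n * u⁻¹)
    (hφ : ∀ u n, d n = 1 → φ u n = n) (hπ : π.range.Normal) (u : U) :
    ∃ α : MulAut (M ⋊[ψ] X), (∀ n, α (inl n) = inl (φ u n)) ∧ ∀ e, π (α e) = u * π e * u⁻¹ := by
  obtain ⟨l, hl⟩ := exists_lift_of_isFreeGroup π ((MulAut.conj u).toMonoidHom.comp (π.comp inr))
    fun x => hπ.conj_mem _ ⟨inr x, rfl⟩ u
  replace hl : ∀ x, π (l x) = u * π (inr x) * u⁻¹ := hl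
  have hψ : ∀ x n, φ (π (inr x)) n = ψ x n := fun x n => inl_injective <| by
    rw [← h.conj, inl_aut, map_inv]
  have hcomm : ∀ x n, inl (φ u (ψ x n)) = l x * inl (φ u n) * (l x)⁻¹ := by
    intro x n
    rw [h.conj, hl, ← hψ]
    simp only [← MulAut.mul_apply, ← map_mul]
    group
  let a : M ⋊[ψ] X →* M ⋊[ψ] X :=
    SemidirectProduct.lift (inl.comp (φ u).toMonoidHom) l fun x => MonoidHom.ext (hcomm x)
  have ha : ∀ n, a (inl n) = inl (φ u n) := fun n => lift_inl _ _ _ n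
  have haπ : π.comp a = (MulAut.conj u).toMonoidHom.comp π := by
    refine SemidirectProduct.hom_ext (MonoidHom.ext fun n => ?_) (MonoidHom.ext fun x => ?_)
    · change π (a (inl n)) = u * π (inl n) * u⁻¹
      rw [ha, h.map_eq, h.map_eq, hd]
    · exact (congrArg π (lift_inr _ _ _ x)).trans (hl x)
  replace haπ : ∀ e, π (a e) = u * π e * u⁻¹ := DFunLike.congr_fun haπ
  exact ⟨MulEquiv.ofBijective a (h.bijective_of_conj hφ hπ ha haπ), ha, haπ⟩

theorem exists_action_of_isFreeGroup [IsFreeGroup Q] (κ : Q →* U)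
    (hα : ∀ u, ∃ α : MulAut E, (∀ n, α (j n) = j (φ u n)) ∧ ∀ e, π (α e) = u * π e * u⁻¹) :
    ∃ θ : Q →* MulAut E, (∀ q n, θ q (j n) = j (φ (κ q) n)) ∧
      ∀ q e, π (θ q e) = κ q * π e * (κ q)⁻¹ := by
  let S : Subgroup (MulAut E × U) :=
    { carrier := {s | (∀ n, s.1 (j n) = j (φ s.2 n)) ∧ ∀ e, π (s.1 e) = s.2 * π e * s.2⁻¹}
      one_mem' := ⟨fun n => by simp, fun e => by simp⟩
      mul_mem' := by
        rintro s t ⟨hs, hs'⟩ ⟨ht, ht'⟩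
        refine ⟨fun n => ?_, fun e => ?_⟩
        · simp only [Prod.fst_mul, Prod.snd_mul, MulAut.mul_apply, map_mul, ht, hs]
        · simp only [Prod.fst_mul, Prod.snd_mul, MulAut.mul_apply, ht', hs', mul_inv_rev,
            mul_assoc]
      inv_mem' := by
        rintro ⟨α, u⟩ ⟨hs, hs'⟩
        refine ⟨fun n => α.injective ?_, fun e => ?_⟩
        · simp [hs]
        · have := hs' (α⁻¹ e)
          rw [MulAut.apply_inv_self] at this
          simp [this, mul_assoc] }
  obtain ⟨l, hl⟩ := exists_lift_of_isFreeGroup ((MonoidHom.snd _ U).comp S.subtype) κ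
    fun q => by
      obtain ⟨α, h⟩ := hα (κ q)
      exact ⟨⟨(α, κ q), h⟩, rfl⟩
  replace hl : ∀ q, (l q : MulAut E × U).2 = κ q := hl
  refine ⟨(MonoidHom.fst _ U).comp (S.subtype.comp l), fun q n => ?_, fun q e => ?_⟩
  · rw [← hl]
    exact (l q).2.1 n
  · rw [← hl]
    exact (l q).2.2 e

/-- The elements `j m` and `σ (d m)` differ by elements of `ker d`, which are central in `E`, so
that `j` and `σ ∘ d` agree on commutators. -/
theorem eq_one_of_mem_closure [IsFreeGroup U] (h : RealizesCrossedModule d φ j π)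
    (hd : ∀ u n, d (φ u n) = u * d n * u⁻¹) (hφ : ∀ u n, d n = 1 → φ u n = n)
    (hπ : Function.Surjective π) {n : M}
    (hn : n ∈ Subgroup.closure {m | ∃ n u, m = n * (φ u n)⁻¹}) (hdn : d n = 1) : n = 1 := by
  obtain ⟨σ, hσ⟩ := exists_section_of_isFreeGroup hπ
  have hcentral : ∀ m e, Commute (j m * (σ (d m))⁻¹) e := by
    intro m e
    have hm : π (j m * (σ (d m))⁻¹) = 1 := by rw [map_mul, map_inv, hσ, h.map_eq, mul_inv_cancel]
    obtain ⟨a, ha⟩ := h.exists_of_map_eq_one _ hm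
    have hea := h.conj e a
    rw [hφ _ a (by rw [← h.map_eq, ha, hm]), mul_inv_eq_iff_eq_mul] at hea
    exact ha ▸ hea.symm
  have key : Subgroup.closure {m | ∃ n u, m = n * (φ u n)⁻¹} ≤ j.eqLocus (σ.comp d) := by
    rw [Subgroup.closure_le]
    rintro _ ⟨m, u, rfl⟩
    calc j (m * (φ u m)⁻¹)
        = ⁅j m, σ u⁆ := by
          rw [map_mul, map_inv, ← hσ u, ← h.conj, hσ, commutatorElement_def]
          group
      _ = ⁅j m * (σ (d m))⁻¹ * σ (d m), 1 * σ u⁆ := by rw [inv_mul_cancel_right, one_mul]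
      _ = ⁅σ (d m), σ u⁆ := commutatorElement_mul_mul_of_commute (hcentral m)
          (Commute.one_left _) (Commute.one_left _)
      _ = σ (d (m * (φ u m)⁻¹)) := by
          simp only [map_mul, map_inv, hd, commutatorElement_def]
          group
  apply h.injective
  rw [map_one, show j n = σ (d n) from key hn, hdn, map_one]

theorem exists_range_eq_ker [IsFreeGroup X] (hpeiffer : ∀ n m, φ (d n) m = n * m * n⁻¹)
    (hd : ∀ u n, d (φ u n) = u * d n * u⁻¹) {q : U →* Q} {r : q.ker →* X}
    (hr : Function.Surjective r) (hdr : r.ker.map q.ker.subtype = d.range) :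
    ∃ (ψ : X →* MulAut M) (π : M ⋊[ψ] X →* U),
      RealizesCrossedModule d φ inl π ∧ π.range = q.ker := by
  obtain ⟨τ, hτ⟩ := exists_section_of_isFreeGroup hr
  obtain ⟨π, hπ, hE⟩ := (refl hpeiffer).exists_semidirectProduct
    (κ := q.ker.subtype.comp τ) (θ := φ.comp (q.ker.subtype.comp τ)) (fun _ _ => rfl)
    (fun _ _ => hd _ _) fun x hx => by
      rw [← hdr] at hx
      obtain ⟨v, hv, e⟩ := hx
      rw [← hτ x, ← Subtype.ext e]
      exact hv
  refine ⟨_, π, hE, le_antisymm ?_ ?_⟩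
  · rintro _ ⟨e, rfl⟩
    obtain ⟨v, -, hv⟩ := hdr.ge ⟨e.left, rfl⟩
    rw [hπ, ← hv]
    exact mul_mem v.2 (τ e.right).2
  · intro v hv
    have hker : (⟨v, hv⟩ : q.ker) * (τ (r ⟨v, hv⟩))⁻¹ ∈ r.ker := by
      rw [MonoidHom.mem_ker, map_mul, map_inv, hτ, mul_inv_cancel]
    obtain ⟨n, hn⟩ := hdr.le ⟨_, hker, rfl⟩
    refine ⟨⟨n, r ⟨v, hv⟩⟩, (hπ _).trans ?_⟩
    rw [hn]
    exact inv_mul_cancel_right _ _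

/-- The extension realising the crossed module over all of `U` is `(M ⋊ X) ⋊ Q`. -/
theorem eq_one_of_free_by_free [IsFreeGroup U] [IsFreeGroup X] [IsFreeGroup Q]
    (hpeiffer : ∀ n m, φ (d n) m = n * m * n⁻¹) (hd : ∀ u n, d (φ u n) = u * d n * u⁻¹)
    (hφ : ∀ u n, d n = 1 → φ u n = n) {q : U →* Q} (hq : Function.Surjective q)
    {r : q.ker →* X} (hr : Function.Surjective r) (hdr : r.ker.map q.ker.subtype = d.range)
    {n : M} (hn : n ∈ Subgroup.closure {m | ∃ n u, m = n * (φ u n)⁻¹}) (hdn : d n = 1) :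
    n = 1 := by
  obtain ⟨κ, hκ⟩ := exists_section_of_isFreeGroup hq
  obtain ⟨ψ, π, hE, hπ_range⟩ := exists_range_eq_ker hpeiffer hd hr hdr
  have hnormal : π.range.Normal := by
    rw [hπ_range]
    infer_instance
  obtain ⟨θ, hθ, hθπ⟩ :=
    exists_action_of_isFreeGroup κ (hE.exists_mulAut_of_isFreeGroup hd hφ hnormal)
  obtain ⟨ϖ, hϖ, hE'⟩ := hE.exists_semidirectProduct hθ hθπ fun y hy => by
    rw [hπ_range, MonoidHom.mem_ker, hκ] at hy
    exact hy
  refine hE'.eq_one_of_mem_closure hd hφ (fun u => ?_) hn hdn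
  have hu : u * (κ (q u))⁻¹ ∈ π.range := by
    rw [hπ_range, MonoidHom.mem_ker, map_mul, map_inv, hκ, mul_inv_cancel]
  obtain ⟨e, he⟩ := hu
  exact ⟨⟨e, q u⟩, (hϖ _).trans (by rw [he, inv_mul_cancel_right])⟩

end RealizesCrossedModule

namespace NormalPair

variable {A B C : NormalPair.{u}}

/-! ### Vanishing of `K2` over free groups -/

instance (A : NormalPair.{u}) : IsFreeGroup (susp A).G := inferInstanceAs (IsFreeGroup (UGrp A.G))

theorem K2.subsingleton_of_section {σ : A.G →* UGrp A.G} (hσ : ∀ x, UGrp.ev (σ x) = x)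
    (hN : ∀ x ∈ A.N, σ x ∈ A.V) : Subsingleton A.K2 := by
  refine subsingleton_of_forall_eq 1 fun x => ?_
  obtain ⟨z, rfl⟩ := K2.mk_surjective A x
  let mk := QuotientGroup.mk' A.T
  have hR : ∀ w, w * (σ (UGrp.ev w))⁻¹ ∈ A.R := fun w => by
    rw [mem_R_iff, map_mul, map_inv, hσ, mul_inv_cancel]
  have hV : ∀ v ∈ A.V, σ (UGrp.ev v) ∈ A.V := fun v hv => hN _ (ev_mem_of_mem_V hv)
  have key : mk z = mk (σ (UGrp.ev (z : UGrp A.G))) :=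
    eq_of_mem_commutator_of_commute (g := mk.comp (σ.comp UGrp.ev))
      (fun v hv => mk'_J_commute ⟨A.V.mul_mem hv (A.V.inv_mem (hV v hv)), hR v⟩)
      (fun w _ v hv => mk'_R_commute (hR w) (hV v hv)) z.2.2
  rw [mem_R_iff.mp z.2.1.2, map_one, map_one] at key
  exact K2.mk_eq_one_iff.mpr ((QuotientGroup.eq_one_iff _).mp key)

theorem K2.subsingleton_of_free [IsFreeGroup A.G] {E : Type u} [Group E] [IsFreeGroup E]
    {p : A.G →* E} (hp : Function.Surjective p) (hN : p.ker = A.N) : Subsingleton A.K2 := by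
  obtain ⟨τ, hτ⟩ := exists_section_of_isFreeGroup (UGrp.ev_surjective (F := E))
  obtain ⟨σ, hσ⟩ := exists_lift_of_isFreeGroup ((UGrp.ev (F := A.G)).prod (UGrp.map p))
    ((MonoidHom.id A.G).prod (τ.comp p)) fun x => by
      obtain ⟨w, hw⟩ := UGrp.map_surjective hp (τ (p x))
      have hx : p ((UGrp.ev w)⁻¹ * x) = 1 := by
        rw [map_mul, map_inv, ← UGrp.ev_map, hw, hτ, inv_mul_cancel]
      refine ⟨w * UGrp.u ((UGrp.ev w)⁻¹ * x), Prod.ext ?_ ?_⟩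
      · change UGrp.ev (w * UGrp.u ((UGrp.ev w)⁻¹ * x)) = x
        rw [map_mul, UGrp.ev_u, mul_inv_cancel_left]
      · change UGrp.map p (w * UGrp.u ((UGrp.ev w)⁻¹ * x)) = τ (p x)
        rw [map_mul, UGrp.map_u, hx, UGrp.u_one, mul_one, hw]
  have hσp : ∀ x, UGrp.map p (σ x) = τ (p x) := fun x => congrArg Prod.snd (hσ x)
  refine K2.subsingleton_of_section (fun x => congrArg Prod.fst (hσ x)) fun x hx => ?_
  rw [← hN, MonoidHom.mem_ker] at hx
  rw [← ker_map_eq_V hN, MonoidHom.mem_ker, hσp, hx, map_one]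

theorem K2.map_bijective_of_free [IsFreeGroup B.G] [IsFreeGroup C.G] {p : Hom B C}
    (hp : Function.Surjective p.toHom) (hN : ∀ x, p.toHom x ∈ C.N → x ∈ B.N) :
    Function.Bijective (K2.map p) := by
  let A : NormalPair.{u} := ⟨B.G, p.toHom.ker⟩
  have hA : IsFreeGroup A.G := inferInstanceAs (IsFreeGroup B.G)
  let i : Hom A B := ⟨MonoidHom.id B.G, fun x hx => hN x (MonoidHom.mem_ker.mp hx ▸ one_mem _)⟩
  have h : IsExtension i p :=
    { bijective := Function.bijective_id
      surjective := hp
      ker_eq := (Subgroup.map_id _).symm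
      map_eq := by
        apply le_antisymm (Subgroup.map_le_iff_le_comap.mpr p.mem)
        intro y hy
        obtain ⟨x, rfl⟩ := hp y
        exact ⟨x, hN x hy, rfl⟩ }
  obtain ⟨δ, hδ⟩ := h.exists_boundaryOne
  have hA' : Subsingleton A.K2 := K2.subsingleton_of_free hp rfl
  constructor
  · rw [injective_iff_map_eq_one]
    intro x hx
    obtain ⟨y, rfl⟩ := (h.exact_K2 x).mp hx
    rw [Subsingleton.elim y 1, map_one]
  · intro x
    refine (h.exact_K2_boundaryOne hδ x).mp ?_
    have hx : K1.map i (δ x) = 1 := (h.exact_boundaryOne_K1 hδ _).mpr ⟨x, rfl⟩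
    obtain ⟨a, ha⟩ := K1.mk_surjective A (δ x)
    rw [← ha, K1.map_mk_eq_one_iff] at hx
    rw [← ha, K1.mk_eq_one_iff]
    obtain ⟨s, hs⟩ := exists_section_of_isFreeGroup hp
    exact ker_inf_commutator_le_of_section hs ⟨a.2, Subgroup.commutator_mono le_top le_rfl hx⟩

/-- The canonical `F`-central extension `U_{N,F} / T` of `N`, inside `U_F / T`. -/
noncomputable def centralExt (A : NormalPair.{u}) : Subgroup (UGrp A.G ⧸ A.T) :=
  A.V.map (QuotientGroup.mk' A.T)

/-- The crossed module `U_{N,F} / T → F` given by evaluation. -/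
noncomputable def centralExtEv (A : NormalPair.{u}) : A.centralExt →* A.G :=
  (QuotientGroup.lift A.T UGrp.ev fun _ hw => (T_le_J hw).2).comp A.centralExt.subtype

instance (A : NormalPair.{u}) : A.centralExt.Normal :=
  Subgroup.Normal.map inferInstance _ (QuotientGroup.mk'_surjective _)

/-- The class in `U_{N,F} / T` of an element of `U_{N,F}`. -/
noncomputable def centralExtMk (A : NormalPair.{u}) : A.V →* A.centralExt :=
  (QuotientGroup.mk' A.T).subgroupMap A.V

theorem centralExtMk_surjective (A : NormalPair.{u}) : Function.Surjective A.centralExtMk :=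
  (QuotientGroup.mk' A.T).subgroupMap_surjective A.V

theorem range_centralExtEv (A : NormalPair.{u}) : A.centralExtEv.range = A.N := by
  rw [← map_ev_V]
  ext x
  constructor
  · rintro ⟨n, rfl⟩
    obtain ⟨v, rfl⟩ := A.centralExtMk_surjective n
    exact ⟨v, v.2, rfl⟩
  · rintro ⟨v, hv, rfl⟩
    exact ⟨A.centralExtMk ⟨v, hv⟩, rfl⟩

theorem exists_centralExt_action (A : NormalPair.{u}) : ∃ φ : A.G →* MulAut A.centralExt,
    ∀ w n, (φ (UGrp.ev w) n : UGrp A.G ⧸ A.T) = QuotientGroup.mk' A.T w * n *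
      (QuotientGroup.mk' A.T w)⁻¹ := by
  obtain ⟨φ, hφ⟩ := exists_factorization_of_ker_le (UGrp.ev_surjective (F := A.G))
    (r := (MulAut.conjNormal (H := A.centralExt)).comp (QuotientGroup.mk' A.T)) fun r hr => by
      refine MulEquiv.ext fun n => Subtype.ext ?_
      obtain ⟨v, rfl⟩ := A.centralExtMk_surjective n
      change QuotientGroup.mk' A.T r * QuotientGroup.mk' A.T v * (QuotientGroup.mk' A.T r)⁻¹ = _
      rw [(mk'_R_commute hr v.2).eq, mul_inv_cancel_right]
      rfl
  exact ⟨φ, fun w n => by rw [hφ]; exact MulAut.conjNormal_apply _ _⟩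

theorem exists_mk'_eq_of_mem_commutator {φ : A.G →* MulAut A.centralExt}
    (hφ : ∀ w n, (φ (UGrp.ev w) n : UGrp A.G ⧸ A.T) = QuotientGroup.mk' A.T w * n *
      (QuotientGroup.mk' A.T w)⁻¹) {w : UGrp A.G} (hw : w ∈ ⁅A.V, (⊤ : Subgroup (UGrp A.G))⁆) :
    ∃ n ∈ Subgroup.closure {m | ∃ n u, m = n * (φ u n)⁻¹},
      (n : UGrp A.G ⧸ A.T) = QuotientGroup.mk' A.T w := by
  suffices ⁅A.V, (⊤ : Subgroup (UGrp A.G))⁆ ≤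
      ((Subgroup.closure {m | ∃ n u, m = n * (φ u n)⁻¹}).map A.centralExt.subtype).comap
        (QuotientGroup.mk' A.T) from this hw
  rw [Subgroup.commutator_le]
  intro v hv w _
  let m := A.centralExtMk ⟨v, hv⟩
  refine ⟨m * (φ (UGrp.ev w) m)⁻¹, Subgroup.subset_closure ⟨m, _, rfl⟩, ?_⟩
  change _ * (φ (UGrp.ev w) m : UGrp A.G ⧸ A.T)⁻¹ = _
  rw [hφ, map_commutatorElement, commutatorElement_def]
  simp only [mul_inv_rev, inv_inv, mul_assoc]
  rfl

theorem K2.subsingleton_of_free_by_free [IsFreeGroup A.G] {Q X : Type u} [Group Q] [Group X]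
    [IsFreeGroup Q] [IsFreeGroup X] {q : A.G →* Q} (hq : Function.Surjective q)
    {r : q.ker →* X} (hr : Function.Surjective r) (hN : r.ker.map q.ker.subtype = A.N) :
    Subsingleton A.K2 := by
  obtain ⟨φ, hφ⟩ := A.exists_centralExt_action
  refine subsingleton_of_forall_eq 1 fun x => ?_
  obtain ⟨z, rfl⟩ := K2.mk_surjective A x
  obtain ⟨n, hn, hnz⟩ := exists_mk'_eq_of_mem_commutator hφ z.2.2
  have hdn : A.centralExtEv n = 1 := by
    have : n = A.centralExtMk ⟨z, z.2.1.1⟩ := Subtype.ext hnz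
    rw [this]
    exact z.2.1.2
  have hn_one : n = 1 := by
    refine RealizesCrossedModule.eq_one_of_free_by_free ?_ ?_ ?_ hq hr
      (hN.trans A.range_centralExtEv.symm) hn hdn
    · intro m n
      obtain ⟨v, rfl⟩ := A.centralExtMk_surjective m
      exact Subtype.ext (hφ v n)
    · intro g n
      obtain ⟨w, rfl⟩ := UGrp.ev_surjective g
      change QuotientGroup.lift A.T UGrp.ev (fun _ hw => (T_le_J hw).2)
        (φ (UGrp.ev w) n : UGrp A.G ⧸ A.T) = _
      rw [hφ, map_mul, map_mul, map_inv]
      rfl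
    · intro g n hn
      obtain ⟨w, rfl⟩ := UGrp.ev_surjective g
      obtain ⟨v, rfl⟩ := A.centralExtMk_surjective n
      refine Subtype.ext ((hφ _ _).trans ?_)
      rw [mul_inv_eq_iff_eq_mul]
      exact (mk'_J_commute ⟨v.2, hn⟩ _).eq.symm
  refine K2.mk_eq_one_iff.mpr ((QuotientGroup.eq_one_iff _).mp ?_)
  exact hnz.symm.trans (congrArg Subtype.val hn_one)

instance K2.subsingleton_susp_of_free (A : NormalPair.{u}) [IsFreeGroup A.N] :
    Subsingleton (susp A).K2 := by
  let r : A.V →* A.N :=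
    (UGrp.ev.comp A.V.subtype).codRestrict A.N fun v => ev_mem_of_mem_V v.2
  have hr : Function.Surjective r := fun x =>
    ⟨⟨UGrp.u x, u_mem_V x.2⟩, Subtype.ext (UGrp.ev_u _)⟩
  refine K2.subsingleton_of_free_by_free (A := susp A) (q := UGrp.map (QuotientGroup.mk' A.N))
    (UGrp.map_surjective (QuotientGroup.mk'_surjective _)) (r := r) hr ?_
  ext w
  constructor
  · rintro ⟨v, hv, rfl⟩
    exact ⟨v.2, congrArg Subtype.val hv⟩
  · rintro ⟨hV, hR⟩
    exact ⟨⟨w, hV⟩, Subtype.ext hR, rfl⟩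

/-! ### First and second order exactness in terms of free covers -/

/-- The pair `(J_F, U_F)`; its `K2` is the third homology of `F`. -/
noncomputable def rel (A : NormalPair.{u}) : NormalPair.{u} := ⟨UGrp A.G, A.R⟩

/-- The pair of `U_F` and the preimage of `N`; its `K2` is the third homology of `F / N`. -/
noncomputable def pull (A : NormalPair.{u}) : NormalPair.{u} := ⟨UGrp A.G, A.N.comap UGrp.ev⟩

instance (A : NormalPair.{u}) : IsFreeGroup (rel A).G := inferInstanceAs (IsFreeGroup (UGrp A.G))
instance (A : NormalPair.{u}) : IsFreeGroup (pull A).G := inferInstanceAs (IsFreeGroup (UGrp A.G))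

/-- The inclusion `(J_{N,F}, U_F) ⊆ (J_F, U_F)`. -/
noncomputable def suspToRel (A : NormalPair.{u}) : Hom (susp A) (rel A) :=
  ⟨MonoidHom.id (UGrp A.G), fun _ hx => hx.2⟩

/-- The inclusion of `(J_F, U_F)` into the preimage of `(N,F)`. -/
noncomputable def relToPull (A : NormalPair.{u}) : Hom (rel A) (pull A) :=
  ⟨MonoidHom.id (UGrp A.G), MonoidHom.ker_le_comap UGrp.ev A.N⟩

/-- The evaluation from the preimage of `(N,F)` to `(N,F)`. -/
noncomputable def pullEv (A : NormalPair.{u}) : Hom (pull A) A := ⟨UGrp.ev, fun _ hx => hx⟩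

/-- The morphism `(J_F, U_F) → (J_G, U_G)` induced by a morphism of pairs. -/
noncomputable def Hom.rel (f : Hom A B) : Hom (NormalPair.rel A) (NormalPair.rel B) :=
  ⟨UGrp.map f.toHom, f.map_R⟩

/-- The morphism of preimages in the free covers induced by a morphism of pairs. -/
noncomputable def Hom.pull (f : Hom A B) : Hom (NormalPair.pull A) (NormalPair.pull B) :=
  ⟨UGrp.map f.toHom, fun (w : UGrp A.G) hw => by
    change UGrp.ev (UGrp.map f.toHom w) ∈ B.N
    rw [UGrp.ev_map]
    exact f.mem _ hw⟩

theorem Hom.map_suspToRel (f : Hom A B) (x : (NormalPair.susp A).K2) :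
    K2.map (suspToRel B) (K2.map f.susp x) = K2.map f.rel (K2.map (suspToRel A) x) :=
  K2.map_map_of_comm (fun _ => by rfl) x

theorem Hom.map_relToPull (f : Hom A B) (x : (NormalPair.rel A).K2) :
    K2.map (relToPull B) (K2.map f.rel x) = K2.map f.pull (K2.map (relToPull A) x) :=
  K2.map_map_of_comm (fun _ => by rfl) x

theorem Hom.map_pullEv (f : Hom A B) (x : (NormalPair.pull A).K2) :
    K2.map (pullEv B) (K2.map f.pull x) = K2.map f (K2.map (pullEv A) x) :=
  K2.map_map_of_comm (UGrp.ev_map f.toHom) x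

theorem K2.map_relToPull_suspToRel (x : (susp A).K2) :
    K2.map (relToPull A) (K2.map (suspToRel A) x) = 1 := by
  let W : NormalPair.{u} := ⟨UGrp A.G, A.V⟩
  have : IsFreeGroup W.G := inferInstanceAs (IsFreeGroup (UGrp A.G))
  have hW : Subsingleton W.K2 :=
    K2.subsingleton_of_free (UGrp.map_surjective (QuotientGroup.mk'_surjective A.N)) rfl
  let f : Hom (susp A) W := ⟨MonoidHom.id (UGrp A.G), fun _ hx => hx.1⟩
  let g : Hom W (pull A) := ⟨MonoidHom.id (UGrp A.G), fun _ hx => ev_mem_of_mem_V hx⟩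
  have hfg : K2.map (relToPull A) (K2.map (suspToRel A) x) = K2.map g (K2.map f x) :=
    K2.map_map_of_comm (fun _ => by rfl) x
  rw [hfg, Subsingleton.elim (K2.map f x) 1, map_one]

theorem isExtension_pullEv (A : NormalPair.{u}) : IsExtension (relToPull A) (pullEv A) where
  bijective := Function.bijective_id
  surjective := UGrp.ev_surjective
  ker_eq := (Subgroup.map_id (G := UGrp A.G) A.R).symm
  map_eq := Subgroup.map_comap_eq_self_of_surjective UGrp.ev_surjective _

theorem K2.map_rel_bijective {f : Hom A B} (hf : Function.Bijective f.toHom) :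
    Function.Bijective (K2.map f.rel) := by
  refine K2.map_bijective_of_free (UGrp.map_surjective hf.2) fun (w : UGrp A.G) hw => ?_
  apply hf.1
  rw [← UGrp.ev_map, map_one]
  exact hw

namespace IsExtension

variable {i : Hom A B} {p : Hom B C}

theorem bijective_pull (h : IsExtension i p) : Function.Bijective (K2.map p.pull) := by
  refine K2.map_bijective_of_free (UGrp.map_surjective h.surjective)
    fun (w : UGrp B.G) hw => h.mem_iff_map_mem.mpr ?_
  rw [← UGrp.ev_map]
  exact hw

/-- The morphism from the preimage of `(N,F)` to `(J_E, U_E)`, where `E = F / N`. -/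
noncomputable def pullToRel (h : IsExtension i p) : Hom (pull A) (rel C) :=
  ⟨(UGrp.map p.toHom).comp (UGrp.map i.toHom), fun (w : UGrp A.G) hw => by
    change UGrp.ev (UGrp.map p.toHom (UGrp.map i.toHom w)) = 1
    rw [UGrp.ev_map, UGrp.ev_map]
    exact h.comp_eq_one _ hw⟩

theorem map_pullToRel_relToPull (h : IsExtension i p) (x : (rel A).K2) :
    K2.map h.pullToRel (K2.map (relToPull A) x) = K2.map p.rel (K2.map i.rel x) :=
  K2.map_map_of_comm (fun _ => by rfl) x

theorem map_relToPull_pullToRel (h : IsExtension i p) (x : (pull A).K2) :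
    K2.map (relToPull C) (K2.map h.pullToRel x) = K2.map p.pull (K2.map i.pull x) :=
  K2.map_map_of_comm (fun _ => by rfl) x

theorem bijective_pullToRel (h : IsExtension i p) : Function.Bijective (K2.map h.pullToRel) := by
  refine K2.map_bijective_of_free ((UGrp.map_surjective h.surjective).comp
    (UGrp.map_surjective h.bijective.2)) fun (w : UGrp A.G) hw => h.mem_iff.mpr ?_
  rw [← UGrp.ev_map, ← UGrp.ev_map]
  exact hw

end IsExtension

/-- The projection `(J_E, U_E) → (J_{E/P}, F̄)`. -/
noncomputable def relToDerived (C : NormalPair.{u}) : Hom (rel C) (derived C) :=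
  ⟨QuotientGroup.mk' C.J, fun x hx => ⟨x, hx, rfl⟩⟩

/-- The projection from the preimage of `(P,E)` to `(J_{E/P} × P, F̄)`. -/
noncomputable def pullToDerivedProd (C : NormalPair.{u}) : Hom (pull C) (derivedProd C) :=
  ⟨QuotientGroup.mk' C.J, fun x hx => ⟨x, by rw [R_sup_V]; exact hx, rfl⟩⟩

theorem isExtension_relToDerived (C : NormalPair.{u}) :
    IsExtension (suspToRel C) (relToDerived C) where
  bijective := Function.bijective_id
  surjective := QuotientGroup.mk'_surjective C.J
  ker_eq := (QuotientGroup.ker_mk' C.J).trans (Subgroup.map_id (G := UGrp C.G) C.J).symm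
  map_eq := rfl

theorem isExtension_pullToDerivedProd (C : NormalPair.{u}) :
    IsExtension ((relToPull C).comp (suspToRel C)) (pullToDerivedProd C) where
  bijective := Function.bijective_id
  surjective := QuotientGroup.mk'_surjective C.J
  ker_eq := (QuotientGroup.ker_mk' C.J).trans (Subgroup.map_id (G := UGrp C.G) C.J).symm
  map_eq := by
    change (C.N.comap UGrp.ev).map (QuotientGroup.mk' C.J) = (C.R ⊔ C.V).map _
    rw [R_sup_V]

theorem map_derivedIncl_relToDerived (x : (rel C).K2) :
    K2.map (derivedIncl C) (K2.map (relToDerived C) x) =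
      K2.map (pullToDerivedProd C) (K2.map (relToPull C) x) :=
  K2.map_map_of_comm (fun _ => by rfl) x

theorem exactFirst_iff (C : NormalPair.{u}) :
    C.ExactFirst ↔ Function.MulExact (K2.map (suspToRel C)) (K2.map (relToPull C)) := by
  have e := isExtension_relToDerived C
  have e' := isExtension_pullToDerivedProd C
  constructor
  · refine fun hC x => ⟨fun hx => (e.exact_K2 x).mp (hC ?_), ?_⟩
    · rw [map_derivedIncl_relToDerived, hx, map_one, map_one]
    · rintro ⟨t, rfl⟩
      exact K2.map_relToPull_suspToRel t
  · intro hC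
    rw [ExactFirst, injective_iff_map_eq_one]
    intro x hx
    obtain ⟨δ, hδ⟩ := e.exists_boundaryOne
    obtain ⟨δ', hδ'⟩ := e'.exists_boundaryOne
    let f : Hom (susp C) (susp C) := ⟨MonoidHom.id _, fun _ hx => hx⟩
    have hf : Function.Injective (K1.map f) :=
      K1.map_injective_of_bijective Function.bijective_id fun _ hx => hx
    have hδx : K1.map f (δ x) = δ' (K2.map (derivedIncl C) x) :=
      e.boundaryOne_natural hδ hδ' f (relToPull C) (derivedIncl C) (fun _ => rfl) (fun _ => rfl) x
    rw [hx, map_one, map_eq_one_iff _ hf] at hδx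
    obtain ⟨y, rfl⟩ := (e.exact_K2_boundaryOne hδ x).mp hδx
    rw [map_derivedIncl_relToDerived] at hx
    obtain ⟨z, hz⟩ := (e'.exact_K2 _).mp hx
    rw [K2.map_comp, K2.map_relToPull_suspToRel] at hz
    exact (e.exact_K2 y).mpr ((hC y).mp hz.symm)

instance (A : NormalPair.{u}) : IsFreeGroup (derived A).N := by
  let f : UGrp A.G ⧸ A.J →* UGrp (A.G ⧸ A.N) :=
    QuotientGroup.lift A.J (UGrp.map (QuotientGroup.mk' A.N)) fun _ hw => hw.1
  refine isFreeGroup_of_disjoint_ker f (Subgroup.disjoint_def.mpr ?_)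
  rintro _ ⟨w, hw, rfl⟩ hf
  exact (QuotientGroup.eq_one_iff w).mpr ⟨hf, hw⟩

theorem K2.map_pullEv_bijective [IsFreeGroup A.G] : Function.Bijective (K2.map (pullEv A)) :=
  K2.map_bijective_of_free UGrp.ev_surjective fun _ hw => hw

theorem exactFirst_iff_injective [IsFreeGroup C.N] :
    C.ExactFirst ↔ Function.Injective (K2.map (relToPull C)) := by
  rw [exactFirst_iff, injective_iff_map_eq_one]
  refine forall_congr' fun x => ⟨fun hx h => ?_, fun hx => ⟨fun h => ⟨1, ?_⟩, ?_⟩⟩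
  · obtain ⟨t, rfl⟩ := hx.mp h
    rw [Subsingleton.elim t 1, map_one]
  · rw [map_one, hx h]
  · rintro ⟨t, rfl⟩
    exact K2.map_relToPull_suspToRel t

theorem exactSecond_iff (A : NormalPair.{u}) :
    A.ExactSecond ↔ Function.Injective (K2.map (suspToRel A)) := by
  have e := isExtension_relToDerived A
  have hD : K2.map (relToPull (derived A)) ∘ K2.map e.pullToRel =
      K2.map (relToDerived A).pull ∘ K2.map (suspToRel A).pull :=
    funext e.map_relToPull_pullToRel
  have hA : K2.map (pullEv (rel A)) ∘ K2.map (suspToRel A).pull =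
      K2.map (suspToRel A) ∘ K2.map (pullEv (susp A)) :=
    funext (suspToRel A).map_pullEv
  rw [ExactSecond, exactFirst_iff_injective,
    ← Function.Injective.of_comp_iff' _ e.bijective_pullToRel, hD,
    e.bijective_pull.1.of_comp_iff, ← K2.map_pullEv_bijective.1.of_comp_iff, hA,
    Function.Injective.of_comp_iff' _ K2.map_pullEv_bijective]

/-! ### The boundary map in degree three -/

namespace IsExtension

variable {i : Hom A B} {p : Hom B C}

/-- The boundary map `K^J_3(P,E) → K^J_2(N,F)`. -/
noncomputable def boundary (h : IsExtension i p) : K2 (susp C) →* K2 A :=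
  (K2.map (pullEv A)).comp ((MulEquiv.ofBijective _ h.bijective_pullToRel).symm.toMonoidHom.comp
    (K2.map (suspToRel C)))

theorem boundary_eq (h : IsExtension i p) {x : K2 (susp C)} {y : K2 (pull A)}
    (hy : K2.map h.pullToRel y = K2.map (suspToRel C) x) :
    h.boundary x = K2.map (pullEv A) y :=
  congrArg _ ((MulEquiv.symm_apply_eq (MulEquiv.ofBijective _ h.bijective_pullToRel)).mpr hy.symm)

theorem boundary_cone (h : IsExtension i p) (x : K2 (cone i)) :
    h.boundary (K2.map (coneToSusp i p h.comp_eq_one) x) = K2.map (coneFst i) x := by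
  let e := MulEquiv.ofBijective i.toHom h.bijective
  have hei : ∀ a, e.symm.toMonoidHom (i.toHom a) = a := e.symm_apply_apply
  have hie : i.toHom.comp e.symm.toMonoidHom = MonoidHom.id B.G :=
    MonoidHom.ext e.apply_symm_apply
  let g : (cone i).G →* UGrp A.G := (UGrp.map e.symm.toMonoidHom).comp
    ((MonoidHom.snd A.G (UGrp B.G)).comp (coneGroup i).subtype)
  have hg : ∀ c : coneGroup i, UGrp.ev (g c) = c.1.1 := by
    intro c
    have hc : i.toHom c.1.1 = UGrp.ev c.1.2 := c.2
    change UGrp.ev (UGrp.map _ c.1.2) = _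
    rw [UGrp.ev_map, ← hc, hei]
  let f : Hom (cone i) (pull A) := ⟨g, fun (c : coneGroup i) hc => by
    change UGrp.ev (g c) ∈ A.N
    rw [hg]
    exact hc.1⟩
  have hf : K2.map h.pullToRel (K2.map f x) =
      K2.map (suspToRel C) (K2.map (coneToSusp i p h.comp_eq_one) x) := by
    refine K2.map_map_of_comm (fun c => ?_) x
    change UGrp.map p.toHom (UGrp.map i.toHom (UGrp.map e.symm.toMonoidHom c.1.2)) =
      UGrp.map p.toHom c.1.2
    rw [UGrp.map_map i.toHom, hie, UGrp.map_id]
    rfl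
  rw [h.boundary_eq hf, ← K2.map_comp]
  exact congrArg (fun k => K2.map k x) (Hom.ext hg)

theorem boundary_map (h : IsExtension i p) (z : K2 (susp B)) :
    h.boundary (K2.map p.susp z) = 1 := by
  obtain ⟨y, hy⟩ := (K2.map_rel_bijective h.bijective).2 (K2.map (suspToRel B) z)
  rw [h.boundary_eq (y := K2.map (relToPull A) y)]
  · exact ((isExtension_pullEv A).exact_K2 _).mpr ⟨y, rfl⟩
  · rw [h.map_pullToRel_relToPull, hy, p.map_suspToRel]

theorem map_pull_eq_one (h : IsExtension i p) {y : K2 (pull A)} {t : K2 (susp C)}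
    (hy : K2.map h.pullToRel y = K2.map (suspToRel C) t) : K2.map i.pull y = 1 := by
  apply h.bijective_pull.1
  rw [map_one, ← h.map_relToPull_pullToRel, hy, K2.map_relToPull_suspToRel]

theorem map_boundary (h : IsExtension i p) (t : K2 (susp C)) : K2.map i (h.boundary t) = 1 := by
  obtain ⟨y, hy⟩ := h.bijective_pullToRel.2 (K2.map (suspToRel C) t)
  rw [h.boundary_eq hy, ← i.map_pullEv, h.map_pull_eq_one hy, map_one]

theorem exists_map_pullEv_eq (h : IsExtension i p) {x : K2 A} (hx : K2.map i x = 1) :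
    ∃ y, K2.map (pullEv A) y = x := by
  obtain ⟨δ, hδ⟩ := (isExtension_pullEv A).exists_boundaryOne
  obtain ⟨δ', hδ'⟩ := (isExtension_pullEv B).exists_boundaryOne
  refine ((isExtension_pullEv A).exact_K2_boundaryOne hδ x).mp ?_
  have hi : Function.Injective (K1.map i.rel) := by
    refine K1.map_injective_of_bijective ⟨UGrp.map_injective h.bijective.1,
      UGrp.map_surjective h.bijective.2⟩ fun (w : UGrp A.G) hw => h.bijective.1 ?_
    rw [← UGrp.ev_map, map_one]
    exact hw
  apply hi
  rw [(isExtension_pullEv A).boundaryOne_natural hδ hδ' i.rel i.pull i (fun _ => rfl)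
    (fun w => (UGrp.ev_map i.toHom w).symm) x, hx, map_one, map_one]

theorem exact_boundary (h : IsExtension i p) (hC : C.ExactFirst) :
    Function.MulExact h.boundary (K2.map i) := by
  refine fun x => ⟨fun hx => ?_, fun ⟨t, ht⟩ => ht ▸ h.map_boundary t⟩
  obtain ⟨y, rfl⟩ := h.exists_map_pullEv_eq hx
  rw [← i.map_pullEv] at hx
  obtain ⟨z, hz⟩ := ((isExtension_pullEv B).exact_K2 _).mp hx
  obtain ⟨z, rfl⟩ := (K2.map_rel_bijective h.bijective).2 z
  rw [i.map_relToPull] at hz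
  have hz' : K2.map (pullEv A) (K2.map (relToPull A) z) = 1 :=
    ((isExtension_pullEv A).exact_K2 _).mpr ⟨z, rfl⟩
  have hyz : K2.map (relToPull C)
      (K2.map h.pullToRel (y * (K2.map (relToPull A) z)⁻¹)) = 1 := by
    rw [h.map_relToPull_pullToRel, map_mul, map_inv, hz, mul_inv_cancel, map_one]
  obtain ⟨t, ht⟩ := ((exactFirst_iff C).mp hC _).mp hyz
  refine ⟨t, ?_⟩
  rw [h.boundary_eq ht.symm, map_mul, map_inv, hz', inv_one, mul_one]

theorem exact_susp_boundary (h : IsExtension i p) (hB : B.ExactFirst) (hC : C.ExactSecond) :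
    Function.MulExact (K2.map p.susp) h.boundary := by
  refine fun x => ⟨fun hx => ?_, fun ⟨z, hz⟩ => hz ▸ h.boundary_map z⟩
  obtain ⟨y, hy⟩ := h.bijective_pullToRel.2 (K2.map (suspToRel C) x)
  rw [h.boundary_eq hy] at hx
  obtain ⟨y, rfl⟩ := ((isExtension_pullEv A).exact_K2 _).mp hx
  obtain ⟨z, hz⟩ := ((exactFirst_iff B).mp hB (K2.map i.rel y)).mp (by
    rw [i.map_relToPull, h.map_pull_eq_one hy])
  refine ⟨z, (exactSecond_iff C).mp hC ?_⟩
  rw [← hy, p.map_suspToRel, hz, h.map_pullToRel_relToPull]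

theorem exact_susp (h : IsExtension i p) (hA : A.ExactFirst) (hB : B.ExactSecond) :
    Function.MulExact (K2.map i.susp) (K2.map p.susp) := by
  intro x
  constructor
  · intro hx
    obtain ⟨y, hy⟩ := (K2.map_rel_bijective h.bijective).2 (K2.map (suspToRel B) x)
    have hy' : K2.map (relToPull A) y = 1 := by
      apply h.bijective_pullToRel.1
      rw [map_one, h.map_pullToRel_relToPull, hy, ← p.map_suspToRel, hx, map_one]
    obtain ⟨z, rfl⟩ := ((exactFirst_iff A).mp hA y).mp hy'
    refine ⟨z, (exactSecond_iff B).mp hB ?_⟩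
    rw [← hy, i.map_suspToRel]
  · rintro ⟨z, rfl⟩
    rw [← K2.map_comp]
    exact K2.map_eq_one (susp_comp_eq_one i p h.comp_eq_one) z

theorem injective_susp (h : IsExtension i p) (hA : A.ExactSecond) :
    Function.Injective (K2.map i.susp) := by
  have hinj := (K2.map_rel_bijective h.bijective).1.comp ((exactSecond_iff A).mp hA)
  have hcomm : K2.map i.rel ∘ K2.map (suspToRel A) = K2.map (suspToRel B) ∘ K2.map i.susp :=
    funext fun x => (i.map_suspToRel x).symm
  rw [hcomm] at hinj
  exact hinj.of_comp

end IsExtension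

end NormalPair

/-! ### Splitting at `K^J_2(P,E)` -/

theorem exists_injective_to_divisible (M : Type*) [AddCommGroup M] :
    ∃ ε : M →ₗ[ℤ] CharacterModule M → AddCircle (1 : ℚ), Function.Injective ε :=
  ⟨{ toFun := fun x c => c x
     map_add' := fun x y => funext fun c => map_add c x y
     map_smul' := fun n x => funext fun c => map_zsmul c n x },
    (injective_iff_map_eq_zero _).mpr fun _ hx =>
      CharacterModule.eq_zero_of_character_apply fun c => congrFun hx c⟩

/-- The Cartan–Eilenberg argument: submodules of projective `ℤ`-modules are projective because
quotients of divisible groups are divisible, hence injective. -/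
theorem projective_int_submodule {P : Type*} [AddCommGroup P] [Module.Projective ℤ P]
    (N : Submodule ℤ P) : Module.Projective ℤ N := by
  refine .of_lifting_property'' fun f hf => ?_
  obtain ⟨ε, hε⟩ := exists_injective_to_divisible (N →₀ ℤ)
  let S := (LinearMap.ker f).map ε
  let _ : DivisibleBy ((CharacterModule (N →₀ ℤ) → AddCircle (1 : ℚ)) ⧸ S) ℤ :=
    (Submodule.mkQ_surjective S).divisibleBy _ fun n x => map_zsmul S.mkQ x n
  let g := (LinearMap.ker f).mapQ S ε (Submodule.le_comap_map _ _) ∘ₗ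
    (f.quotKerEquivOfSurjective hf).symm.toLinearMap
  have hg (x : N →₀ ℤ) : g (f x) = S.mkQ (ε x) :=
    congrArg ((LinearMap.ker f).mapQ S ε (Submodule.le_comap_map _ _))
      ((f.quotKerEquivOfSurjective hf).symm_apply_apply (Submodule.Quotient.mk x))
  obtain ⟨e, he⟩ := Module.Baer.extension_property (Module.Baer.of_divisible _) N.subtype
    N.subtype_injective g
  obtain ⟨l, hl⟩ := Module.projective_lifting_property S.mkQ e S.mkQ_surjective
  have hlift (x : N →₀ ℤ) : ∃ y ∈ LinearMap.ker f, ε (x + y) = l (f x) := by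
    have hmk : S.mkQ (ε x) = S.mkQ (l (f x)) :=
      (hg x).symm.trans ((LinearMap.congr_fun he (f x)).symm.trans (LinearMap.congr_fun hl _).symm)
    obtain ⟨y, hy, hxy⟩ := (Submodule.Quotient.eq S).mp hmk.symm
    exact ⟨y, hy, by rw [map_add, hxy, add_sub_cancel]⟩
  let r := (LinearEquiv.ofInjective ε hε).symm.toLinearMap ∘ₗ
    (l ∘ₗ N.subtype).codRestrict (LinearMap.range ε) fun n => by
      obtain ⟨x, rfl⟩ := hf n
      obtain ⟨y, -, hxy⟩ := hlift x
      exact ⟨x + y, hxy⟩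
  refine ⟨r, LinearMap.ext fun n => ?_⟩
  obtain ⟨x, rfl⟩ := hf n
  obtain ⟨y, hy, hxy⟩ := hlift x
  have hr : r (f x) = x + y :=
    (LinearEquiv.symm_apply_eq _).mpr (Subtype.ext hxy.symm)
  rw [LinearMap.comp_apply, hr, map_add, LinearMap.mem_ker.mp hy, add_zero, LinearMap.id_apply]

theorem exists_retraction_of_exact_projective {L K P : Type*} [AddCommGroup L] [AddCommGroup K]
    [AddCommGroup P] [Module.Projective ℤ P] {c : L →ₗ[ℤ] K} {f : K →ₗ[ℤ] P}
    (hc : Function.Injective c) (hcf : Function.Exact c f) : ∃ r : K →ₗ[ℤ] L, r ∘ₗ c = .id := by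
  have := projective_int_submodule (LinearMap.range f)
  have hexact : Function.Exact c f.rangeRestrict := fun x =>
    Subtype.ext_iff.trans (hcf x)
  exact (hexact.split_tfae hc f.surjective_rangeRestrict).out 0 1 |>.mp
    (Module.projective_lifting_property _ _ f.surjective_rangeRestrict)

theorem exists_retraction_of_mulExact {L K Q : Type*} [CommGroup L] [CommGroup K] [CommGroup Q]
    [Module.Projective ℤ (Additive Q)] {c : L →* K} {f : K →* Q}
    (hc : Function.Injective c) (hcf : Function.MulExact c f) : ∃ r : K →* L, ∀ l, r (c l) = l := by
  obtain ⟨r, hr⟩ := exists_retraction_of_exact_projective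
    (c := c.toAdditive.toIntLinearMap) (f := f.toAdditive.toIntLinearMap) hc hcf
  exact ⟨AddMonoidHom.toMultiplicative r.toAddMonoidHom, fun l => LinearMap.congr_fun hr l⟩

namespace NormalPair

variable {A B C : NormalPair.{u}}

theorem J_inf_commutator_le_Z : A.J ⊓ ⁅(⊤ : Subgroup (UGrp A.G)), ⊤⁆ ≤ A.Z := by
  obtain ⟨s, hs⟩ := exists_section_of_isFreeGroup
    (UGrp.map_surjective (QuotientGroup.mk'_surjective A.N))
  exact fun w hw => ⟨hw.1, ker_inf_commutator_le_of_section hs ⟨hw.1.1, hw.2⟩⟩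

/-- The abelian group `J_{N,F} / ([J_{N,F}, U_F] [U_{N,F}, J_F])`, in which `K^J_2(N,F)` is the
kernel of the map to the abelianization of `U_F`. -/
abbrev relatorQuotient (A : NormalPair.{u}) : Type u := A.J ⧸ A.T.subgroupOf A.J

noncomputable instance (A : NormalPair.{u}) : CommGroup A.relatorQuotient where
  mul_comm := by
    intro a b
    obtain ⟨a, rfl⟩ := QuotientGroup.mk'_surjective _ a
    obtain ⟨b, rfl⟩ := QuotientGroup.mk'_surjective _ b
    refine mk'_commute_of_commutator_le (Subgroup.commutator_le.mpr fun g _ k _ => ?_)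
      (Subgroup.mem_top a) (Subgroup.mem_top b)
    exact commutator_J_le_T
      (Subgroup.commutator_mem_commutator g.2 (Subgroup.mem_top (k : UGrp A.G)))

theorem exists_retraction_J (A : NormalPair.{u}) :
    ∃ ρ : A.J →* A.K2, ∀ (j : A.J) (hj : (j : UGrp A.G) ∈ A.Z), ρ j = K2.mk A ⟨j, hj⟩ := by
  let c : A.K2 →* A.relatorQuotient := QuotientGroup.map (A.T.subgroupOf A.Z)
    (A.T.subgroupOf A.J) (Subgroup.inclusion inf_le_left) fun _ hw => hw
  have hc : Function.Injective c := by
    refine (injective_iff_map_eq_one c).mpr fun x hx => ?_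
    obtain ⟨z, rfl⟩ := K2.mk_surjective A x
    exact K2.mk_eq_one_iff.mpr ((QuotientGroup.eq_one_iff (Subgroup.inclusion inf_le_left z)).mp hx)
  have hab (w : UGrp A.G) :
      Abelianization.of w = 1 ↔ w ∈ ⁅(⊤ : Subgroup (UGrp A.G)), (⊤ : Subgroup (UGrp A.G))⁆ := by
    rw [← MonoidHom.mem_ker, Abelianization.ker_of, commutator_def]
  have hle : ⁅A.V, ⊤⁆ ≤ ⁅(⊤ : Subgroup (UGrp A.G)), ⊤⁆ := Subgroup.commutator_mono le_top le_rfl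
  let f : A.relatorQuotient →* Abelianization (UGrp A.G) :=
    QuotientGroup.lift _ (Abelianization.of.comp A.J.subtype) fun w hw =>
      (hab w).mpr (hle (T_le_commutator hw))
  have hcf : Function.MulExact c f := by
    intro k
    obtain ⟨j, rfl⟩ := QuotientGroup.mk'_surjective _ k
    refine ⟨fun hj => ⟨K2.mk A ⟨j, J_inf_commutator_le_Z ⟨j.2, (hab j).mp hj⟩⟩, rfl⟩, ?_⟩
    rintro ⟨x, hx⟩
    obtain ⟨z, rfl⟩ := K2.mk_surjective A x
    rw [← hx]
    exact (hab z).mpr (hle z.2.2)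
  have : Module.Projective ℤ (Additive (Abelianization (UGrp A.G))) :=
    inferInstanceAs (Module.Projective ℤ (FreeAbelianGroup {x : A.G // x ≠ 1}))
  obtain ⟨r, hr⟩ := exists_retraction_of_mulExact hc hcf
  exact ⟨r.comp (QuotientGroup.mk' _), fun j hj => hr (K2.mk A ⟨j, hj⟩)⟩

theorem PartiallyAdmissible.exists_subgroup {N₀ : Subgroup A.G} (hA : A.PartiallyAdmissible N₀) :
    ∃ X : Subgroup (UGrp A.G), ⁅A.V, ⊤⁆ ≤ X ∧ X ≤ A.V ∧ X ⊓ A.J ≤ A.Z ∧ X.map UGrp.ev = N₀ := by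
  obtain ⟨X, -, hXV, hVX, hXJ, hXN⟩ := hA
  have hcomap {Y : Subgroup (UGrp A.G)} (hY : A.T ≤ Y) :
      (Y.map (QuotientGroup.mk' A.T)).comap (QuotientGroup.mk' A.T) = Y :=
    Subgroup.comap_map_eq_self (by rwa [QuotientGroup.ker_mk'])
  refine ⟨X.comap (QuotientGroup.mk' A.T), Subgroup.map_le_iff_le_comap.mp hVX, ?_, ?_, hXN⟩
  · exact (Subgroup.comap_mono hXV).trans (hcomap (T_le_J.trans inf_le_left)).le
  · rw [← hcomap T_le_J, ← hcomap T_le_Z, ← Subgroup.comap_inf, hXJ]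

theorem IsExtension.exists_mem_sup_map_eq {i : Hom A B} {p : Hom B C} (h : IsExtension i p)
    {X : Subgroup (UGrp A.G)} (hXV : X ≤ A.V)
    (hX : A.N ⊓ (⁅B.N, (⊤ : Subgroup B.G)⁆).comap i.toHom ≤ X.map UGrp.ev) {y : UGrp C.G}
    (hy : y ∈ C.Z) :
    ∃ j ∈ B.J ⊓ (⁅B.V, ⊤⁆ ⊔ X.map (UGrp.map i.toHom)), UGrp.map p.toHom j = y := by
  obtain ⟨w, hw, hwy, a, ha, hwa⟩ := h.exists_lift_Z hy
  have haB : i.toHom a ∈ ⁅B.N, (⊤ : Subgroup B.G)⁆ := by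
    rw [← hwa, ← map_ev_commutator]
    exact Subgroup.mem_map_of_mem _ hw
  obtain ⟨x, hx, rfl⟩ := hX ⟨ha, haB⟩
  refine ⟨w * UGrp.map i.toHom x⁻¹, ⟨⟨?_, ?_⟩, ?_⟩, ?_⟩
  · exact mul_mem (commutator_V_le hw) (i.map_V (inv_mem (hXV hx)))
  · change UGrp.ev _ = 1
    rw [map_mul, UGrp.ev_map, hwa, map_inv, map_inv, mul_inv_cancel]
  · exact Subgroup.mul_mem_sup hw (Subgroup.mem_map_of_mem _ (inv_mem hx))
  · rw [map_mul, hwy, h.mem_V_iff.mp (inv_mem (hXV hx)), mul_one]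

theorem IsExtension.mul_map_mem_Z {i : Hom A B} {p : Hom B C} (h : IsExtension i p)
    {X : Subgroup (UGrp A.G)} (hVX : ⁅A.V, ⊤⁆ ≤ X) (hXJ : X ⊓ A.J ≤ A.Z) (hXV : X ≤ A.V)
    {w : UGrp B.G} (hw : w ∈ ⁅B.V, (⊤ : Subgroup (UGrp B.G))⁆) (hwT : UGrp.map p.toHom w ∈ C.T)
    {x : UGrp A.G} (hx : x ∈ X) (hwx : UGrp.ev (w * UGrp.map i.toHom x) = 1) :
    w * UGrp.map i.toHom x ∈ B.Z := by
  obtain ⟨t, ht, a, ha, rfl⟩ := h.exists_mul_map_eq hw hwT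
  rw [mul_assoc, ← map_mul] at hwx ⊢
  have hax : UGrp.ev (a * x) = 1 := by
    rw [map_mul, mem_R_iff.mp (T_le_J ht).2, one_mul, UGrp.ev_map] at hwx
    exact (map_eq_one_iff _ h.bijective.1).mp hwx
  have haxX : a * x ∈ X := mul_mem (hVX ha) hx
  exact mul_mem (T_le_Z ht) (i.map_Z (hXJ ⟨haxX, hXV haxX, hax⟩))

theorem IsExtension.exists_projection {i : Hom A B} {p : Hom B C} (h : IsExtension i p)
    (hA : A.PartiallyAdmissible (A.N ⊓ (⁅B.N, (⊤ : Subgroup B.G)⁆).comap i.toHom)) :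
    ∃ r : K2 C →* K2 C, (∀ x, r x ∈ (K2.map p).range) ∧ ∀ x ∈ (K2.map p).range, r x = x := by
  obtain ⟨X, hVX, hXV, hXJ, hXN⟩ := hA.exists_subgroup
  obtain ⟨ρ, hρ⟩ := exists_retraction_J B
  let W : Subgroup (UGrp B.G) := B.J ⊓ (⁅B.V, ⊤⁆ ⊔ X.map (UGrp.map i.toHom))
  have hW (j : W) : ∃ w ∈ ⁅B.V, (⊤ : Subgroup (UGrp B.G))⁆, ∃ x ∈ X,
      w * UGrp.map i.toHom x = j ∧ UGrp.map p.toHom w = UGrp.map p.toHom (j : UGrp B.G) := by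
    obtain ⟨w, hw, _, ⟨x, hx, rfl⟩, hwx⟩ := Subgroup.mem_sup_of_normal_left.mp j.2.2
    exact ⟨w, hw, x, hx, hwx, by rw [← hwx, map_mul, h.mem_V_iff.mp (hXV hx), mul_one]⟩
  have hWZ (j : W) : UGrp.map p.toHom (j : UGrp B.G) ∈ C.Z := by
    obtain ⟨w, hw, -, -, -, hwj⟩ := hW j
    exact ⟨p.map_J j.2.1, hwj ▸ p.map_commutator_V hw⟩
  let q : W →* K2 C := (K2.mk C).comp (((UGrp.map p.toHom).comp W.subtype).codRestrict C.Z hWZ)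
  let s : W →* K2 C := (K2.map p).comp (ρ.comp (Subgroup.inclusion inf_le_left))
  have hs (j : W) (hj : (j : UGrp B.G) ∈ B.Z) : s j = q j :=
    (congrArg (K2.map p) (hρ (Subgroup.inclusion inf_le_left j) hj)).trans (K2.map_mk _ _)
  have hq : Function.Surjective q := by
    intro y
    obtain ⟨y, rfl⟩ := K2.mk_surjective C y
    obtain ⟨j, hj, hjy⟩ := h.exists_mem_sup_map_eq hXV hXN.ge y.2
    exact ⟨⟨j, hj⟩, congrArg (K2.mk C) (Subtype.ext hjy)⟩
  have hqs : q.ker ≤ s.ker := by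
    intro j hj
    obtain ⟨w, hw, x, hx, hwx, hwj⟩ := hW j
    have hwT : UGrp.map p.toHom w ∈ C.T := hwj ▸ K2.mk_eq_one_iff.mp hj
    have hZ := h.mul_map_mem_Z hVX hXJ hXV hw hwT hx (hwx ▸ j.2.1.2)
    rw [MonoidHom.mem_ker, hs j (hwx ▸ hZ), hj]
  obtain ⟨r, hr⟩ := exists_factorization_of_ker_le hq hqs
  refine ⟨r, fun y => ?_, ?_⟩
  · obtain ⟨j, rfl⟩ := hq y
    exact ⟨_, (hr j).symm⟩
  · rintro _ ⟨x, rfl⟩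
    obtain ⟨z, rfl⟩ := K2.mk_surjective B x
    let j : W := ⟨z, z.2.1, Subgroup.mem_sup_left z.2.2⟩
    exact (hr j).trans (hs j z.2)

end NormalPair

/-! ### Vanishing in higher degrees -/

theorem mulExact_of_subsingleton {G H K : Type*} [Group G] [Group H] [Group K] [Subsingleton H]
    (f : G →* H) (g : H →* K) : Function.MulExact f g := fun _ =>
  ⟨fun _ => ⟨1, Subsingleton.elim _ _⟩,
    fun _ => (congrArg g (Subsingleton.elim _ 1)).trans g.map_one⟩

theorem mulExact_iff_injective_of_subsingleton {G H K : Type*} [Group G] [Group H] [Group K]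
    [Subsingleton G] {f : G →* H} {g : H →* K} : Function.MulExact f g ↔ Function.Injective g := by
  refine ⟨fun hfg => (injective_iff_map_eq_one g).mpr fun y hy => ?_, fun hg y => ?_⟩
  · obtain ⟨x, rfl⟩ := (hfg y).mp hy
    rw [Subsingleton.elim x 1, map_one]
  · rw [map_eq_one_iff g hg]
    refine ⟨fun hy => ⟨1, hy ▸ map_one f⟩, ?_⟩
    rintro ⟨x, rfl⟩
    rw [Subsingleton.elim x 1, map_one]

namespace NormalPair

variable {A B C : NormalPair.{u}}

instance (A : NormalPair.{u}) : IsFreeGroup (susp A).N := inferInstanceAs (IsFreeGroup A.J)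
instance (A : NormalPair.{u}) : IsFreeGroup (pull A).N :=
  inferInstanceAs (IsFreeGroup (A.N.comap UGrp.ev))

instance (k : ℕ) (A : NormalPair.{u}) : Subsingleton (KJ (k + 2) A) :=
  K2.subsingleton_susp_of_free (susp (iterSusp k A))

theorem Hom.bijective_iterSusp {f : Hom A B} (hf : Function.Bijective f.toHom) (k : ℕ) :
    Function.Bijective (f.iterSusp k).toHom := by
  induction k with
  | zero => exact hf
  | succ k ih => exact ⟨UGrp.map_injective ih.1, UGrp.map_surjective ih.2⟩

theorem exists_isExtension {f : Hom A B} (hf : Function.Bijective f.toHom) :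
    ∃ (C : NormalPair.{u}) (p : Hom B C), IsExtension f p := by
  have hA : (A.N.map f.toHom).Normal := .map inferInstance _ hf.2
  have hB : (B.N.map (QuotientGroup.mk' (A.N.map f.toHom))).Normal :=
    .map inferInstance _ (QuotientGroup.mk'_surjective _)
  exact ⟨⟨B.G ⧸ A.N.map f.toHom, B.N.map (QuotientGroup.mk' (A.N.map f.toHom))⟩,
    ⟨QuotientGroup.mk' _, fun x hx => ⟨x, hx, rfl⟩⟩, hf, QuotientGroup.mk'_surjective _,
    QuotientGroup.ker_mk' _, rfl⟩

theorem IsExtension.isFreeGroup_of_susp {i : Hom A B} {p : Hom B C} (h : IsExtension i p)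
    {D : NormalPair.{u}} {q : Hom (susp B) D} (h' : IsExtension i.susp q) : IsFreeGroup D.N := by
  have hker : q.toHom.ker ≤ (UGrp.map p.toHom).ker := by
    rw [h'.ker_eq, ← h.map_V_eq]
    exact Subgroup.map_mono inf_le_left
  obtain ⟨φ, hφ⟩ := exists_factorization_of_ker_le h'.surjective hker
  refine isFreeGroup_of_disjoint_ker φ (Subgroup.disjoint_def.mpr fun {y} hy hy' => ?_)
  rw [← h'.map_eq] at hy
  obtain ⟨w, ⟨-, hw⟩, rfl⟩ := hy
  have hwV : w ∈ A.V.map (UGrp.map i.toHom) := h.map_V_eq ▸ (hφ w).symm.trans hy'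
  obtain ⟨v, hv, rfl⟩ := hwV
  refine h'.comp_eq_one v ⟨hv, h.bijective.1 ?_⟩
  rw [← UGrp.ev_map, map_one]
  exact hw

theorem K2.map_coneFst_susp {i : Hom A B} (hi : Function.Bijective i.toHom)
    (x : K2 (cone i.susp)) : K2.map (coneFst i.susp) x = 1 := by
  obtain ⟨C, p, h⟩ := exists_isExtension hi
  obtain ⟨D, q, h'⟩ := exists_isExtension (Hom.bijective_iterSusp hi 1)
  have := h.isFreeGroup_of_susp h'
  exact (h'.boundary_cone x).symm.trans
    ((congrArg h'.boundary (Subsingleton.elim _ 1)).trans h'.boundary.map_one)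

/-- The boundary maps `K^J_{k+3}(P,E) → K^J_{k+2}(N,F)`, trivial for `k ≥ 1`. -/
noncomputable def IsExtension.boundaryKJ {i : Hom A B} {p : Hom B C} (h : IsExtension i p) :
    ∀ k : ℕ, KJ (k + 1) C →* KJ k A
  | 0 => h.boundary
  | _ + 1 => 1

theorem IsExtension.isBoundary_boundaryKJ {i : Hom A B} {p : Hom B C} (h : IsExtension i p) :
    ∀ k, IsBoundary h k (h.boundaryKJ k)
  | 0 => h.boundary_cone
  | k + 1 => fun x => (K2.map_coneFst_susp (Hom.bijective_iterSusp h.bijective k) x).symm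

theorem IsExtension.exact_KJ_add_two {i : Hom A B} {p : Hom B C} (h : IsExtension i p) (k : ℕ) :
    Function.MulExact (KJ.map (k + 2) p) (h.boundaryKJ (k + 1)) ∧
      Function.MulExact (h.boundaryKJ (k + 2)) (KJ.map (k + 2) i) ∧
      Function.MulExact (KJ.map (k + 2) i) (KJ.map (k + 2) p) :=
  ⟨mulExact_of_subsingleton _ _, mulExact_of_subsingleton _ _, mulExact_of_subsingleton _ _⟩

theorem IsExtension.exact_boundaryKJ_one {i : Hom A B} {p : Hom B C} (h : IsExtension i p)
    (hA : A.ExactSecond) : Function.MulExact (h.boundaryKJ 1) (KJ.map 1 i) :=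
  mulExact_iff_injective_of_subsingleton.mpr (h.injective_susp hA)

theorem IsExtension.exact_KJ_of_fullyExact {i : Hom A B} {p : Hom B C} (h : IsExtension i p)
    (hA : A.FullyExact) (hB : B.FullyExact) (hC : C.FullyExact) : ∀ k,
    Function.MulExact (KJ.map (k + 1) p) (h.boundaryKJ k) ∧
      Function.MulExact (h.boundaryKJ k) (KJ.map k i) ∧
      Function.MulExact (KJ.map k i) (KJ.map k p)
  | 0 => ⟨h.exact_susp_boundary hB.1 hC.2, h.exact_boundary hC.1, h.exact_K2⟩
  | 1 => ⟨(h.exact_KJ_add_two 0).1, h.exact_boundaryKJ_one hA.2, h.exact_susp hA.1 hB.2⟩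
  | k + 2 => ⟨(h.exact_KJ_add_two (k + 1)).1, (h.exact_KJ_add_two k).2⟩

/-! ### Necessity of the exactness conditions -/

/-- The projection `(J_{E/P} × P, F̄) → (P,E)`. -/
noncomputable def derivedProdEv (C : NormalPair.{u}) : Hom (derivedProd C) C :=
  ⟨QuotientGroup.lift C.J UGrp.ev fun _ hw => hw.2, by
    rintro _ ⟨w, hw, rfl⟩
    rw [R_sup_V] at hw
    exact hw⟩

theorem isExtension_derivedProdEv (C : NormalPair.{u}) :
    IsExtension (derivedIncl C) (derivedProdEv C) where
  bijective := Function.bijective_id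
  surjective := fun x => ⟨QuotientGroup.mk' C.J (UGrp.u x), UGrp.ev_u x⟩
  ker_eq := by
    refine Eq.trans ?_ (Subgroup.map_id (G := UGrp C.G ⧸ C.J) _).symm
    ext x
    obtain ⟨w, rfl⟩ := QuotientGroup.mk'_surjective C.J x
    refine ⟨fun hw => ⟨w, hw, rfl⟩, ?_⟩
    rintro ⟨v, hv, hvw⟩
    rw [← hvw]
    exact hv
  map_eq := by
    apply le_antisymm (Subgroup.map_le_iff_le_comap.mpr (derivedProdEv C).mem)
    intro x hx
    exact ⟨QuotientGroup.mk' C.J (UGrp.u x),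
      ⟨UGrp.u x, Subgroup.mem_sup_right (u_mem_V hx), rfl⟩, UGrp.ev_u x⟩

theorem exists_section_susp_derivedProdEv (C : NormalPair.{u}) :
    ∃ s : Hom (susp C) (susp (derivedProd C)),
      ∀ w, (derivedProdEv C).susp.toHom (s.toHom w) = w := by
  obtain ⟨σ, hev, hmap⟩ := UGrp.exists_section (p := (derivedProdEv C).toHom)
    (q := QuotientGroup.mk' C.J) fun _ => rfl
  refine ⟨⟨σ, fun (w : UGrp C.G) hw => ⟨?_, (hev w).trans ((QuotientGroup.eq_one_iff w).mpr hw)⟩⟩,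
    hmap⟩
  refine (isExtension_derivedProdEv C).mem_V_iff_map_mem.mpr ?_
  change UGrp.map (derivedProdEv C).toHom (σ w) ∈ C.V
  rw [hmap w]
  exact hw.1

theorem exactFirst_of_exact (h : ∀ (A' B' : NormalPair.{u}) (i' : Hom A' B') (p' : Hom B' C)
    (h' : IsExtension i' p') (δ : KJ 1 C →* KJ 0 A'), IsBoundary h' 0 δ →
    Function.MulExact δ (KJ.map 0 i')) : C.ExactFirst := by
  have hext := isExtension_derivedProdEv C
  have hexact := h _ _ _ _ hext hext.boundary hext.boundary_cone
  obtain ⟨s, hs⟩ := exists_section_susp_derivedProdEv C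
  refine (injective_iff_map_eq_one _).mpr fun x hx => ?_
  obtain ⟨t, rfl⟩ := (hexact x).mp hx
  rw [← K2.map_leftInverse hs t]
  exact hext.boundary_map _

theorem exactSecond_of_exact_quotient (h : ∀ (A' B' : NormalPair.{u}) (i' : Hom A' B')
    (p' : Hom B' C) (h' : IsExtension i' p') (δ : KJ 1 C →* KJ 0 A'), IsBoundary h' 0 δ →
    B'.ExactFirst → Function.MulExact (KJ.map 1 p') δ) : C.ExactSecond := by
  have hext := isExtension_pullEv C
  have : Subsingleton (K2 (rel (pull C))) :=
    K2.subsingleton_of_free UGrp.ev_surjective rfl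
  have hexact : Function.MulExact (K2.map (pullEv C).susp) hext.boundary :=
    h _ _ _ _ hext hext.boundary hext.boundary_cone
      ((exactFirst_iff _).mpr (mulExact_of_subsingleton _ _))
  refine (exactSecond_iff C).mpr ((injective_iff_map_eq_one _).mpr fun t ht => ?_)
  have hδt : hext.boundary t = 1 := by rw [hext.boundary_eq (y := 1) (by rw [map_one, ht]), map_one]
  obtain ⟨z, rfl⟩ := (hexact t).mp hδt
  rw [Subsingleton.elim z 1, map_one]

theorem bijective_suspToRel (hA : A.N = ⊤) : Function.Bijective (K2.map (suspToRel A)) := by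
  refine K2.map_bijective_of_bijective Function.bijective_id fun w hw => ⟨?_, hw⟩
  have hmap : UGrp.map (QuotientGroup.mk' A.N) = 1 := UGrp.hom_ext fun x => by
    have hx : QuotientGroup.mk' A.N x = 1 := (QuotientGroup.eq_one_iff x).mpr (hA ▸ trivial)
    rw [UGrp.map_u, hx, UGrp.u_one, MonoidHom.one_apply]
  exact DFunLike.congr_fun hmap w

theorem exists_isExtension_top (A : NormalPair.{u}) :
    ∃ (B C : NormalPair.{u}) (i : Hom A B) (p : Hom B C),
      IsExtension i p ∧ B.N = ⊤ ∧ C.N = ⊤ := by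
  let i : Hom A ⟨A.G, ⊤⟩ := ⟨MonoidHom.id A.G, fun x _ => Subgroup.mem_top x⟩
  obtain ⟨C, p, h⟩ := exists_isExtension (f := i) Function.bijective_id
  refine ⟨_, C, i, p, h, rfl, ?_⟩
  rw [← h.map_eq]
  exact Subgroup.map_top_of_surjective _ h.surjective

theorem exactFirst_of_exact_kernel (h : ∀ (B' C' : NormalPair.{u}) (i' : Hom A B')
    (p' : Hom B' C'), IsExtension i' p' → B'.ExactSecond →
    Function.MulExact (KJ.map 1 i') (KJ.map 1 p')) : A.ExactFirst := by
  obtain ⟨B, C, i, p, hext, hB, hC⟩ := exists_isExtension_top A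
  have hexact : Function.MulExact (K2.map i.susp) (K2.map p.susp) :=
    h B C i p hext ((exactSecond_iff B).mpr (bijective_suspToRel hB).1)
  refine (exactFirst_iff A).mpr fun y => ⟨fun hy => ?_, ?_⟩
  · obtain ⟨x, hx⟩ := (bijective_suspToRel hB).2 (K2.map i.rel y)
    have hpx : K2.map p.susp x = 1 := by
      apply (bijective_suspToRel hC).1
      rw [p.map_suspToRel, hx, ← hext.map_pullToRel_relToPull, hy, map_one, map_one]
    obtain ⟨z, rfl⟩ := (hexact x).mp hpx
    exact ⟨z, (K2.map_rel_bijective hext.bijective).1 ((i.map_suspToRel z).symm.trans hx)⟩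
  · rintro ⟨x, rfl⟩
    exact K2.map_relToPull_suspToRel x

theorem exactSecond_of_exact_kernel (h : ∀ (B' C' : NormalPair.{u}) (i' : Hom A B')
    (p' : Hom B' C') (h' : IsExtension i' p') (δ : KJ 2 C' →* KJ 1 A), IsBoundary h' 1 δ →
    Function.MulExact δ (KJ.map 1 i')) : A.ExactSecond := by
  obtain ⟨B, C, i, p, hext, hB, -⟩ := exists_isExtension_top A
  have hinj : Function.Injective (K2.map i.susp) :=
    mulExact_iff_injective_of_subsingleton.mp (h B C i p hext _ (hext.isBoundary_boundaryKJ 1))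
  have hcomm : K2.map (suspToRel B) ∘ K2.map i.susp = K2.map i.rel ∘ K2.map (suspToRel A) :=
    funext i.map_suspToRel
  rw [exactSecond_iff]
  exact .of_comp (hcomm ▸ (bijective_suspToRel hB).1.comp hinj)

end NormalPair

theorem corollary5p1 {A B C : NormalPair.{u}} (i : Hom A B) (p : Hom B C) (h : IsExtension i p) :
    -- the boundary maps
    (∃ (δ : ∀ k : ℕ, KJ (k + 1) C →* KJ k A) (δ₁ : K2 C →* K1 A),
      (∀ k, IsBoundary h k (δ k)) ∧ IsBoundaryOne i p δ₁ ∧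
      -- for fully exact pairs the sequence is exact at every place
      (A.FullyExact → B.FullyExact → C.FullyExact →
        (∀ k, Function.MulExact (KJ.map (k + 1) p) (δ k) ∧
          Function.MulExact (δ k) (KJ.map k i) ∧
          Function.MulExact (KJ.map k i) (KJ.map k p)) ∧
        Function.MulExact (K2.map p) δ₁ ∧
        Function.MulExact δ₁ (K1.map i) ∧
        Function.MulExact (K1.map i) (K1.map p) ∧
        Function.Surjective (K1.map p)) ∧
      -- exactness at `K^J_2(N,F)`
      (C.ExactFirst → Function.MulExact (δ 0) (KJ.map 0 i)) ∧
      -- exactness at `K^J_3(P,E)`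
      (B.ExactFirst → C.ExactSecond → Function.MulExact (KJ.map 1 p) (δ 0)) ∧
      -- exactness at `K^J_3(M,F)`
      (A.ExactFirst → B.ExactSecond → Function.MulExact (KJ.map 1 i) (KJ.map 1 p)) ∧
      -- exactness at `K^J_3(N,F)`
      (A.ExactSecond → Function.MulExact (δ 1) (KJ.map 1 i)) ∧
      -- exactness at all other places, without any assumption
      (∀ k, Function.MulExact (KJ.map (k + 2) p) (δ (k + 1)) ∧
        Function.MulExact (δ (k + 2)) (KJ.map (k + 2) i) ∧
        Function.MulExact (KJ.map (k + 2) i) (KJ.map (k + 2) p)) ∧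
      Function.MulExact (K2.map i) (K2.map p) ∧
      Function.MulExact (K2.map p) δ₁ ∧
      Function.MulExact δ₁ (K1.map i) ∧
      Function.MulExact (K1.map i) (K1.map p) ∧
      Function.Surjective (K1.map p) ∧
      -- the splitting at `K^J_2(P,E)`
      (A.PartiallyAdmissible (A.N ⊓ (⁅B.N, (⊤ : Subgroup B.G)⁆).comap i.toHom) →
        ∃ r : K2 C →* K2 C, (∀ x, r x ∈ (K2.map p).range) ∧ ∀ x ∈ (K2.map p).range, r x = x)) ∧
    -- the conditions on the quotient pair `(P,E)` are needed: exactness at `K^J_2(N,F)`, resp. at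
    -- `K^J_3(P,E)`, for all extensions with this quotient forces them
    ((∀ (A' B' : NormalPair.{u}) (i' : Hom A' B') (p' : Hom B' C) (h' : IsExtension i' p')
        (δ : KJ 1 C →* KJ 0 A'), IsBoundary h' 0 δ →
        Function.MulExact δ (KJ.map 0 i')) → C.ExactFirst) ∧
    ((∀ (A' B' : NormalPair.{u}) (i' : Hom A' B') (p' : Hom B' C) (h' : IsExtension i' p')
        (δ : KJ 1 C →* KJ 0 A'), IsBoundary h' 0 δ → B'.ExactFirst →
        Function.MulExact (KJ.map 1 p') δ) → C.ExactSecond) ∧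
    -- the conditions on the kernel pair `(N,F)` are needed: exactness at `K^J_3(M,F)`, resp. at
    -- `K^J_3(N,F)`, for all extensions with this kernel forces them
    ((∀ (B' C' : NormalPair.{u}) (i' : Hom A B') (p' : Hom B' C'), IsExtension i' p' →
        B'.ExactSecond → Function.MulExact (KJ.map 1 i') (KJ.map 1 p')) → A.ExactFirst) ∧
    ((∀ (B' C' : NormalPair.{u}) (i' : Hom A B') (p' : Hom B' C') (h' : IsExtension i' p')
        (δ : KJ 2 C' →* KJ 1 A), IsBoundary h' 1 δ →
        Function.MulExact δ (KJ.map 1 i')) → A.ExactSecond) := by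
  obtain ⟨δ₁, hδ₁⟩ := h.exists_boundaryOne
  have hQ := h.exact_K2_boundaryOne hδ₁
  have hN := h.exact_boundaryOne_K1 hδ₁
  exact ⟨⟨h.boundaryKJ, δ₁, h.isBoundary_boundaryKJ, hδ₁,
    fun hA hB hC => ⟨h.exact_KJ_of_fullyExact hA hB hC, hQ, hN, h.exact_K1, h.surjective_K1⟩,
    h.exact_boundary, h.exact_susp_boundary, h.exact_susp, h.exact_boundaryKJ_one,
    h.exact_KJ_add_two, h.exact_K2, hQ, hN, h.exact_K1, h.surjective_K1, h.exists_projection⟩,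
    exactFirst_of_exact, exactSecond_of_exact_quotient, exactFirst_of_exact_kernel,
    exactSecond_of_exact_kernel⟩
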